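/- Let $\mathbb G=(\mathbb R^{m}\times\mathbb R^{n},\circ)$ be a homogeneous Lie group: $\circ$ is a smooth group law for which every dilation $\delta_r(x_1,x_2)=(r x_1,r^2x_2)$, $r>0$, is an automorphism. Let $\mathfrak g$ be its Lie algebra (left-invariant vector fields), with center $\mathfrak z$, and suppose that $\mathfrak g$ is of H-type with respect to a fixed inner product $\langle\cdot,\cdot\rangle$, i.e. $[\mathfrak z^\perp,\mathfrak z^\perp]=\mathfrak z$ and, for every $z\in\mathfrak z$ with $\langle z,z\rangle=1$, the map $J_z:\mathfrak z^\perp\to\mathfrak z^\perp$ defined by $\langle J_z v,w\rangle=\langle z,[v,w]\rangle$ for all $w\in\mathfrak z^\perp$ is orthogonal. (Then $\dim\mathfrak z^\perp=m$ and $\dim\mathfrak z=n$.) Put $Q=m+2n$ and $\|q\|^2=\langle q,q\rangle$. Write $x=\mathrm{Exp}(v(x)+z(x))$ with $v(x)\in\mathfrak z^\perp$, $z(x)\in\mathfrak z$, and let $$B_R(x_0)=x_0\circ\{x\in\mathbb G:\ \|v(x)\|^4+16\|z(x)\|^2<R^4\}.$$ Let $|\cdot|$ be the Lebesgue measure. Let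 $0<\lambda\le\Lambda$ and $0<\delta\le 2$. Then there are constants $\varepsilon\in(0,1)$ and $c>0$, depending only on $\lambda,\Lambda,\delta$ and $\mathbb G$ (with its inner product), such that the following holds. Let $X_1,\dots,X_m$ be an orthonormal basis of $\mathfrak z^\perp$, let $\Omega\subseteq\mathbb G$ be open, and let $A=(a_{ij})$ be a function from $\Omega$ to the symmetric real $m\times m$ matrices such that, for every $x\in\Omega$, $$\lambda\|\xi\|^2\le\langle A(x)\xi,\xi\rangle\le\Lambda\|\xi\|^2\qquad\text{for all }\xi\in\mathbb R^m,$$ and the $\delta$-Landis condition holds: $$\mathrm{Tr}(A(x))+(Q+2-m)\max_{\|\xi\|=1}\langle A(x)\xi,\xi\rangle\le(Q+4-\delta)\min_{\|\xi\|=1}\langle A(x)\xi,\xi\rangle .$$ Then the family of all functions $u\in C^2(V)$, $V\subseteq\Omega$ open, with $u\ge0$ and $\mathcal L_Au=\sum_{i,j=1}^m a_{ij}X_iX_ju\le0$ in $V$ has the critical density property with constants $\varepsilon$ and $c$: for every $x_0\in\mathbb G$ and $R>0$ with $B_{2R}(x_0)\subseteq\Omega$, and every $u$ in the family whose domain contains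 $B_{2R}(x_0)$, $$|\{x\in B_R(x_0):u(x)\ge1\}|\ge\varepsilon\,|B_R(x_0)|\quad\Longrightarrow\quad\inf_{B_{R/2}(x_0)}u\ge c .$$ -/

import Mathlib

open scoped Manifold ContDiff
open MeasureTheory

noncomputable section

/-! ### H-type Lie algebras -/

namespace HType

section LieAlg

variable {L : Type*} [LieRing L] [LieAlgebra ℝ L]

/-- The orthogonal complement `𝔷^⊥` of the center `𝔷` of a real Lie algebra, with respect to a
bilinear form. -/
def horizontal (B : LinearMap.BilinForm ℝ L) : Submodule ℝ L :=
  LinearMap.BilinForm.orthogonal B (LieAlgebra.center ℝ L).toSubmodule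

/-- `B` is an inner product which makes the real Lie algebra `L` an H-type algebra: the brackets of
elements of `𝔷^⊥` span the center `𝔷`, and for each `z ∈ 𝔷` with `⟨z, z⟩ = 1` the map
`J_z : 𝔷^⊥ → 𝔷^⊥` given by `⟨J_z v, w⟩ = ⟨z, [v, w]⟩` is orthogonal. -/
structure IsHTypeInner (B : LinearMap.BilinForm ℝ L) : Prop where
  symm : ∀ v w : L, B v w = B w v
  pos : ∀ v : L, v ≠ 0 → 0 < B v v
  span_bracket :
    Submodule.span ℝ {y : L | ∃ v ∈ horizontal B, ∃ w ∈ horizontal B, ⁅v, w⁆ = y} =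
      (LieAlgebra.center ℝ L).toSubmodule
  orthogonal_J : ∀ z ∈ LieAlgebra.center ℝ L, B z z = 1 →
    ∃ J : horizontal B →ₗ[ℝ] horizontal B,
      (∀ v w : horizontal B, B (J v : L) (w : L) = B z ⁅(v : L), (w : L)⁆) ∧
      ∀ v w : horizontal B, B (J v : L) (J w : L) = B (v : L) (w : L)

/-- `X_1, …, X_m` is an orthonormal basis of `𝔷^⊥`. -/
def IsHorizontalONB {m : ℕ} (B : LinearMap.BilinForm ℝ L) (X : Fin m → L) : Prop :=
  (∀ i j, B (X i) (X j) = if i = j then 1 else 0) ∧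
    Submodule.span ℝ (Set.range X) = horizontal B

end LieAlg

/-! ### Elliptic matrices and the Cordes–Landis condition -/

section Matrices

variable {m : ℕ}

/-- The symmetric `m × m` matrices with `lam ‖ξ‖² ≤ ⟨M ξ, ξ⟩ ≤ Lam ‖ξ‖²` for all `ξ`. -/
def IsElliptic (lam Lam : ℝ) (M : Matrix (Fin m) (Fin m) ℝ) : Prop :=
  M.IsSymm ∧ ∀ ξ : Fin m → ℝ,
    lam * (ξ ⬝ᵥ ξ) ≤ M.mulVec ξ ⬝ᵥ ξ ∧ M.mulVec ξ ⬝ᵥ ξ ≤ Lam * (ξ ⬝ᵥ ξ)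

/-- The values `⟨M ξ, ξ⟩` over the Euclidean unit sphere. -/
def sphereValues (M : Matrix (Fin m) (Fin m) ℝ) : Set ℝ :=
  (fun ξ : Fin m → ℝ => M.mulVec ξ ⬝ᵥ ξ) '' {ξ | ξ ⬝ᵥ ξ = 1}

/-- The `δ`-Landis condition at one point, where `Q = m + 2n`. The supremum and the infimum are
a maximum and a minimum, by compactness of the sphere. -/
def IsLandis (n : ℕ) (δ : ℝ) (M : Matrix (Fin m) (Fin m) ℝ) : Prop :=
  let Q : ℝ := m + 2 * n
  M.trace + (Q + 2 - m) * sSup (sphereValues M) ≤ (Q + 4 - δ) * sInf (sphereValues M)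

end Matrices

/-! ### The critical density property -/

/-- The critical density property with constants `ε` and `c`, for a family `K` of real functions
with domains in `Ω`. A member of the family is a pair of a domain `V` and a function `u`, of which
only the values on `V` are meant. The conclusion says that the infimum of `u` on `B_{R/2}(x₀)` is
at least `c`. -/
def CriticalDensity {G : Type*} [MeasurableSpace G] (μ : Measure G) (ball : G → ℝ → Set G)
    (Ω : Set G) (K : Set (Set G × (G → ℝ))) (ε c : ℝ) : Prop :=
  ∀ (x₀ : G) (R : ℝ), 0 < R → ball x₀ (2 * R) ⊆ Ω →
    ∀ (V : Set G) (u : G → ℝ), (V, u) ∈ K → ball x₀ (2 * R) ⊆ V →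
      ENNReal.ofReal ε * μ (ball x₀ R) ≤ μ {x ∈ ball x₀ R | 1 ≤ u x} →
        ∀ x ∈ ball x₀ (R / 2), c ≤ u x

/-! ### Smooth group laws on a normed space -/

/-- This lets Lean find the Lie algebra structure on the Lie algebra of a smooth real Lie group. -/
instance minSmoothness_leInfty : ENat.LEInfty (minSmoothness ℝ 3) :=
  ⟨by rw [minSmoothness_of_isRCLikeNormedField]; exact ENat.LEInfty.out⟩

section Groups

variable {m : ℕ} {E : Type*} [NormedAddCommGroup E] [NormedSpace ℝ E] [Group E]

variable (E) in
/-- The (multiplicative) group law on the vector space `E` makes it a smooth Lie group, for the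
standard manifold structure of `E`. -/
abbrev SmoothGroup : Prop := LieGroup 𝓘(ℝ, E) ∞ E

variable (E) in
/-- The Lie algebra of the group `E`: the tangent space at the identity, with the Lie bracket of
left-invariant vector fields. -/
abbrev LieAlg : Type _ := GroupLieAlgebra 𝓘(ℝ, E) E

/-- `x = Exp(w)`: `x` is the value at time `1` of the integral curve, starting from the identity, of
the left-invariant vector field given by `w`. -/
def IsExp (w : LieAlg E) (x : E) : Prop :=
  ∃ γ : ℝ → E, γ 0 = 1 ∧ (∀ t : ℝ, HasDerivAt γ (mulInvariantVectorField w (γ t)) t) ∧ γ 1 = x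

/-- The derivative of `f` along the left-invariant vector field given by `w`. -/
def lieDeriv (w : LieAlg E) (f : E → ℝ) (x : E) : ℝ :=
  fderiv ℝ f x (mulInvariantVectorField w x)

/-- The operator `L_A u = ∑ a_{ij} X_i X_j u`. -/
def nondivOp (X : Fin m → LieAlg E) (A : E → Matrix (Fin m) (Fin m) ℝ) (u : E → ℝ) (x : E) : ℝ :=
  ∑ i, ∑ j, A x i j * lieDeriv (X i) (lieDeriv (X j) u) x

/-- The family of the nonnegative `C²` functions `u` on open sets `V ⊆ Ω` with `L_A u ≤ 0`. -/
def supersolutions (X : Fin m → LieAlg E) (Ω : Set E) (A : E → Matrix (Fin m) (Fin m) ℝ) :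
    Set (Set E × (E → ℝ)) :=
  {p | IsOpen p.1 ∧ p.1 ⊆ Ω ∧ ContDiffOn ℝ 2 p.2 p.1 ∧ (∀ x ∈ p.1, 0 ≤ p.2 x) ∧
    ∀ x ∈ p.1, nondivOp X A p.2 x ≤ 0}

/-- The ball `B_R(x₀) = x₀ ∘ {x : ‖v(x)‖⁴ + 16 ‖z(x)‖² < R⁴}`, where `x = Exp(v(x) + z(x))` with
`v(x) ∈ 𝔷^⊥` and `z(x) ∈ 𝔷`, and `‖q‖² = ⟨q, q⟩ = B q q`. -/
def gaugeBall [CompleteSpace E] [SmoothGroup E] (B : LinearMap.BilinForm ℝ (LieAlg E)) (x₀ : E)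
    (R : ℝ) : Set E :=
  (fun x => x₀ * x) '' {x | ∃ v ∈ horizontal B, ∃ z ∈ LieAlgebra.center ℝ (LieAlg E),
    IsExp (v + z) x ∧ (B v v) ^ 2 + 16 * B z z < R ^ 4}

end Groups

/-! ### The space `ℝ^m × ℝ^n` and its dilations -/

/-- The space `ℝ^N = ℝ^m × ℝ^n`. -/
abbrev Space (m n : ℕ) : Type := EuclideanSpace ℝ (Fin m ⊕ Fin n)

/-- The dilation `(x₁, x₂) ↦ (r x₁, r² x₂)`. -/
def dilation {m n : ℕ} (r : ℝ) (x : Space m n) : Space m n :=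
  WithLp.toLp 2 (Sum.elim (fun i => r * x (Sum.inl i)) (fun k => r ^ 2 * x (Sum.inr k)))

end HType

end

/-!
By the Landis condition, with `α = (Q - δ) / 4`, the left translates of `gauge ^ (-α)` satisfy
`L_A ≥ 0` away from their poles, for all coefficients at once. Since `4 α < Q`, this kernel is
locally integrable, so its potential over a compact part of `{u ≥ 1}` is bounded, and `L_A` of the
potential is nonnegative off that part. The weak maximum principle on `{u ≤ 1 / 2}` bounds `u` below
by a fixed multiple of the excess of the potential over its maximum on the unit gauge sphere. That
excess is positive near the origin when the part fills half of a ball about the origin which is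
small enough, since the kernel blows up at its pole. Translations and dilations carry the bound to
other balls and other centers. The constants depend only on the dimensions and `δ`, since the
brackets of H-type lie in the compact unit ball of the space of brackets.
-/

noncomputable section

namespace HType

open Filter Topology InnerProductSpace

section ParametricIntegral

variable {X Y E : Type*} [TopologicalSpace X] [TopologicalSpace Y] [NormedAddCommGroup E]
  {O : Set (X × Y)} {K : Set Y} {F : X → Y → E}

theorem isOpen_setOf_forall_prodMk_mem (hO : IsOpen O) (hK : IsCompact K) :
    IsOpen {x | ∀ y ∈ K, (x, y) ∈ O} :=
  isOpen_iff_eventually.2 fun _ hx =>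
    hK.eventually_forall_of_forall_eventually fun y hy => hO.mem_nhds (hx y hy)

theorem exists_eventually_forall_norm_le (hO : IsOpen O)
    (hF : ContinuousOn (fun t : X × Y => F t.1 t.2) O) (hK : IsCompact K) {x : X}
    (hx : ∀ y ∈ K, (x, y) ∈ O) : ∃ C, ∀ᶠ z in 𝓝 x, ∀ y ∈ K, ‖F z y‖ ≤ C := by
  have hslice : ContinuousOn (F x) K := hF.comp (f := fun y => (x, y)) (by fun_prop) hx
  obtain ⟨C, hC⟩ := hK.exists_bound_of_continuousOn hslice
  refine ⟨C + 1, hK.eventually_forall_of_forall_eventually fun y hy => ?_⟩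
  have hcont : ContinuousAt (fun t : X × Y => ‖F t.1 t.2‖) (x, y) :=
    (hF.continuousAt (hO.mem_nhds (hx y hy))).norm
  exact (hcont.eventually_lt_const ((hC y hy).trans_lt (lt_add_one C))).mono fun _ h => h.le

variable [T2Space Y] [MeasurableSpace Y] [OpensMeasurableSpace Y] {μ : Measure Y}
  [IsFiniteMeasureOnCompacts μ]

theorem integrableOn_of_continuousOn_prod (hF : ContinuousOn (fun t : X × Y => F t.1 t.2) O)
    (hK : IsCompact K) {x : X} (hx : ∀ y ∈ K, (x, y) ∈ O) : IntegrableOn (F x) K μ :=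
  ContinuousOn.integrableOn_compact hK (hF.comp (f := fun y => (x, y)) (by fun_prop) hx)

theorem continuousOn_setIntegral [NormedSpace ℝ E] [FirstCountableTopology X] (hO : IsOpen O)
    (hF : ContinuousOn (fun t : X × Y => F t.1 t.2) O) (hK : IsCompact K) :
    ContinuousOn (fun x => ∫ y in K, F x y ∂μ) {x | ∀ y ∈ K, (x, y) ∈ O} := by
  intro x hx
  obtain ⟨C, hC⟩ := exists_eventually_forall_norm_le hO hF hK hx
  refine (continuousAt_of_dominated (bound := fun _ => C) ?_ ?_ ?_ ?_).continuousWithinAt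
  · filter_upwards [(isOpen_setOf_forall_prodMk_mem hO hK).mem_nhds hx] with z hz
    exact (integrableOn_of_continuousOn_prod hF hK hz).aestronglyMeasurable
  · filter_upwards [hC] with z hz
    exact (ae_restrict_iff' hK.measurableSet).2 (ae_of_all _ hz)
  · exact integrableOn_const hK.measure_lt_top.ne
  · filter_upwards [ae_restrict_mem hK.measurableSet] with y hy
    exact (hF.continuousAt (hO.mem_nhds (hx y hy))).comp (f := fun z => (z, y)) (by fun_prop)

end ParametricIntegral

section ParametricDerivative

variable {M N E : Type*} [NormedAddCommGroup M] [NormedSpace ℝ M] [NormedAddCommGroup N]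
  [NormedSpace ℝ N] [NormedAddCommGroup E] [NormedSpace ℝ E] {O : Set (M × N)} {F : M → N → E}

/-- The derivative of `F : M → N → E` in its first variable. -/
def partialFDeriv (F : M → N → E) (z : M) (e : N) : M →L[ℝ] E := fderiv ℝ (fun z => F z e) z

theorem partialFDeriv_eq {z : M} {e : N}
    (hF : DifferentiableAt ℝ (fun t : M × N => F t.1 t.2) (z, e)) :
    partialFDeriv F z e =
      (fderiv ℝ (fun t : M × N => F t.1 t.2) (z, e)).comp (ContinuousLinearMap.inl ℝ M N) :=
  (HasFDerivAt.comp (f := fun z : M => (z, e)) z hF.hasFDerivAt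
    (hasFDerivAt_prodMk_left z e)).fderiv

theorem contDiffOn_partialFDeriv (hO : IsOpen O) {j k : WithTop ℕ∞} (hjk : j + 1 ≤ k)
    (hF : ContDiffOn ℝ k (fun t : M × N => F t.1 t.2) O) :
    ContDiffOn ℝ j (fun t : M × N => partialFDeriv F t.1 t.2) O := by
  refine ((hF.fderiv_of_isOpen hO hjk).clm_comp
    (contDiffOn_const (c := ContinuousLinearMap.inl ℝ M N))).congr fun t ht => ?_
  have hk : k ≠ 0 := by rintro rfl; simp at hjk
  exact partialFDeriv_eq ((hF.differentiableOn hk).differentiableAt (hO.mem_nhds ht))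

theorem hasFDerivAt_partialFDeriv (hO : IsOpen O)
    (hF : ContDiffOn ℝ 1 (fun t : M × N => F t.1 t.2) O) {t : M × N} (ht : t ∈ O) :
    HasFDerivAt (fun z => F z t.2) (partialFDeriv F t.1 t.2) t.1 :=
  (((hF.differentiableOn one_ne_zero).differentiableAt (hO.mem_nhds ht)).comp
    (f := fun z => (z, t.2)) t.1 (by fun_prop)).hasFDerivAt

variable {K : Set N} [MeasurableSpace N] [OpensMeasurableSpace N] {μ : Measure N}
  [IsFiniteMeasureOnCompacts μ]

omit [NormedSpace ℝ N] in
theorem hasFDerivAt_setIntegral (hO : IsOpen O) (hF : ContinuousOn (fun t : M × N => F t.1 t.2) O)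
    {F' : M → N → M →L[ℝ] E} (hFF' : ∀ t ∈ O, HasFDerivAt (fun z => F z t.2) (F' t.1 t.2) t.1)
    (hF' : ContinuousOn (fun t : M × N => F' t.1 t.2) O) (hK : IsCompact K) {x : M}
    (hx : ∀ e ∈ K, (x, e) ∈ O) :
    HasFDerivAt (fun z => ∫ e in K, F z e ∂μ) (∫ e in K, F' x e ∂μ) x := by
  obtain ⟨C, hC⟩ := exists_eventually_forall_norm_le hO hF' hK hx
  have hnear := (isOpen_setOf_forall_prodMk_mem hO hK).mem_nhds hx
  refine hasFDerivAt_integral_of_dominated_of_fderiv_le (bound := fun _ => C)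
    (inter_mem hnear hC) ?_ (integrableOn_of_continuousOn_prod hF hK hx)
    (integrableOn_of_continuousOn_prod hF' hK hx).aestronglyMeasurable ?_
    (integrableOn_const hK.measure_lt_top.ne) ?_
  · filter_upwards [hnear] with z hz
    exact (integrableOn_of_continuousOn_prod hF hK hz).aestronglyMeasurable
  · filter_upwards [ae_restrict_mem hK.measurableSet] with e he z hz using hz.2 e he
  · filter_upwards [ae_restrict_mem hK.measurableSet] with e he z hz using hFF' _ (hz.1 e he)

theorem hasFDerivAt_setIntegral_of_contDiffOn (hO : IsOpen O)
    (hF : ContDiffOn ℝ 1 (fun t : M × N => F t.1 t.2) O) (hK : IsCompact K) {x : M}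
    (hx : ∀ e ∈ K, (x, e) ∈ O) :
    HasFDerivAt (fun z => ∫ e in K, F z e ∂μ) (∫ e in K, partialFDeriv F x e ∂μ) x :=
  hasFDerivAt_setIntegral hO hF.continuousOn (fun _ => hasFDerivAt_partialFDeriv hO hF)
    (contDiffOn_partialFDeriv (j := 0) hO (by simp) hF).continuousOn hK hx

theorem contDiffOn_one_setIntegral (hO : IsOpen O)
    (hF : ContDiffOn ℝ 1 (fun t : M × N => F t.1 t.2) O) (hK : IsCompact K) :
    ContDiffOn ℝ 1 (fun z => ∫ e in K, F z e ∂μ) {z | ∀ e ∈ K, (z, e) ∈ O} := by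
  have hder {z : M} (hz : ∀ e ∈ K, (z, e) ∈ O) :=
    hasFDerivAt_setIntegral_of_contDiffOn (μ := μ) hO hF hK hz
  rw [← zero_add 1, contDiffOn_succ_iff_fderiv_of_isOpen
    (isOpen_setOf_forall_prodMk_mem hO hK), contDiffOn_zero]
  refine ⟨fun z hz => (hder hz).differentiableAt.differentiableWithinAt, by simp, ?_⟩
  exact (continuousOn_setIntegral hO
    (contDiffOn_partialFDeriv (j := 0) hO (by simp) hF).continuousOn hK).congr
      fun z hz => (hder hz).fderiv

theorem contDiffOn_two_setIntegral (hO : IsOpen O)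
    (hF : ContDiffOn ℝ 2 (fun t : M × N => F t.1 t.2) O) (hK : IsCompact K) :
    ContDiffOn ℝ 2 (fun z => ∫ e in K, F z e ∂μ) {z | ∀ e ∈ K, (z, e) ∈ O} := by
  have hder {z : M} (hz : ∀ e ∈ K, (z, e) ∈ O) :=
    hasFDerivAt_setIntegral_of_contDiffOn (μ := μ) hO (hF.of_le one_le_two) hK hz
  rw [← one_add_one_eq_two, contDiffOn_succ_iff_fderiv_of_isOpen
    (isOpen_setOf_forall_prodMk_mem hO hK)]
  refine ⟨fun z hz => (hder hz).differentiableAt.differentiableWithinAt, by simp, ?_⟩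
  exact (contDiffOn_one_setIntegral hO
    (contDiffOn_partialFDeriv hO one_add_one_eq_two.le hF) hK).congr
      fun z hz => (hder hz).fderiv

end ParametricDerivative

section FieldDeriv

variable {M N ι : Type*} [NormedAddCommGroup M] [NormedSpace ℝ M] [NormedAddCommGroup N]
  [NormedSpace ℝ N] {X X₁ X₂ : M → M} {f g : M → ℝ} {x : M}

/-- The derivative of `f` along the vector field `X`. -/
def fieldDeriv (X : M → M) (f : M → ℝ) (x : M) : ℝ := fderiv ℝ f x (X x)

theorem fieldDeriv_congr (h : f =ᶠ[𝓝 x] g) : fieldDeriv X f x = fieldDeriv X g x := by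
  rw [fieldDeriv, h.fderiv_eq, fieldDeriv]

theorem contDiffAt_fieldDeriv (hX : ContDiffAt ℝ 1 X x) (hf : ContDiffAt ℝ 2 f x) :
    ContDiffAt ℝ 1 (fieldDeriv X f) x :=
  (hf.fderiv_right one_add_one_eq_two.le).clm_apply hX

theorem fieldDeriv_add (hf : DifferentiableAt ℝ f x) (hg : DifferentiableAt ℝ g x) :
    fieldDeriv X (f + g) x = fieldDeriv X f x + fieldDeriv X g x := by
  simp only [fieldDeriv, fderiv_add hf hg, add_apply]

theorem fieldDeriv_smul (ρ : ℝ) (f : M → ℝ) : fieldDeriv X (ρ • f) = ρ • fieldDeriv X f := by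
  ext x
  simp only [fieldDeriv, fderiv_const_smul_field, Pi.smul_apply, smul_apply]

theorem fieldDeriv_sum_smul_field [Fintype ι] (s : ι → ℝ) (Y : ι → M → M) (f : M → ℝ) :
    fieldDeriv (∑ i, s i • Y i) f = ∑ i, s i • fieldDeriv (Y i) f := by
  ext x
  simp only [fieldDeriv, Finset.sum_apply, Pi.smul_apply, map_sum, map_smul]

theorem fieldDeriv_sum_smul [Fintype ι] (s : ι → ℝ) {f : ι → M → ℝ}
    (hf : ∀ i, DifferentiableAt ℝ (f i) x) :
    fieldDeriv X (∑ i, s i • f i) x = ∑ i, s i * fieldDeriv X (f i) x := by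
  simp only [fieldDeriv, fderiv_sum fun i _ => (hf i).const_smul (s i), fderiv_const_smul_field,
    Pi.smul_apply, sum_apply, smul_apply, smul_eq_mul]

theorem fieldDeriv_comp {T : N → M} {Y : N → N} {y : N} {ρ : ℝ} (hT : DifferentiableAt ℝ T y)
    (hf : DifferentiableAt ℝ f (T y)) (h : fderiv ℝ T y (Y y) = ρ • X (T y)) :
    fieldDeriv Y (f ∘ T) y = ρ * fieldDeriv X f (T y) := by
  simp only [fieldDeriv, fderiv_comp y hf hT, ContinuousLinearMap.comp_apply, h, map_smul,
    smul_eq_mul]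

theorem fieldDeriv_fieldDeriv_add (hX₂ : ContDiffAt ℝ 1 X₂ x) (hf : ContDiffAt ℝ 2 f x)
    (hg : ContDiffAt ℝ 2 g x) :
    fieldDeriv X₁ (fieldDeriv X₂ (f + g)) x =
      fieldDeriv X₁ (fieldDeriv X₂ f) x + fieldDeriv X₁ (fieldDeriv X₂ g) x := by
  have hadd : fieldDeriv X₂ (f + g) =ᶠ[𝓝 x] fieldDeriv X₂ f + fieldDeriv X₂ g := by
    filter_upwards [hf.eventually (by simp), hg.eventually (by simp)] with z hfz hgz
    exact fieldDeriv_add (hfz.differentiableAt two_ne_zero) (hgz.differentiableAt two_ne_zero)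
  rw [fieldDeriv_congr hadd, fieldDeriv_add
    ((contDiffAt_fieldDeriv hX₂ hf).differentiableAt one_ne_zero)
    ((contDiffAt_fieldDeriv hX₂ hg).differentiableAt one_ne_zero)]

theorem fieldDeriv_fieldDeriv_comp {T : N → M} {Y₁ Y₂ : N → N} {y : N} {ρ : ℝ}
    (hT : ContDiff ℝ 1 T) (hX₂ : ContDiffAt ℝ 1 X₂ (T y)) (hf : ContDiffAt ℝ 2 f (T y))
    (h₁ : ∀ z, fderiv ℝ T z (Y₁ z) = ρ • X₁ (T z))
    (h₂ : ∀ z, fderiv ℝ T z (Y₂ z) = ρ • X₂ (T z)) :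
    fieldDeriv Y₁ (fieldDeriv Y₂ (f ∘ T)) y = ρ ^ 2 * fieldDeriv X₁ (fieldDeriv X₂ f) (T y) := by
  have hTd : Differentiable ℝ T := hT.differentiable one_ne_zero
  have hcomp : fieldDeriv Y₂ (f ∘ T) =ᶠ[𝓝 y] ρ • (fieldDeriv X₂ f ∘ T) := by
    filter_upwards [hT.continuous.continuousAt.eventually (hf.eventually (by simp))] with z hz
    exact fieldDeriv_comp (hTd z) (hz.differentiableAt two_ne_zero) (h₂ z)
  rw [fieldDeriv_congr hcomp, fieldDeriv_smul, Pi.smul_apply, smul_eq_mul,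
    fieldDeriv_comp (hTd y) ((contDiffAt_fieldDeriv hX₂ hf).differentiableAt one_ne_zero) (h₁ y)]
  ring

end FieldDeriv

section MaximumPrinciple

variable {M N ι : Type*} [NormedAddCommGroup M] [NormedSpace ℝ M] [NormedAddCommGroup N]
  [NormedSpace ℝ N]

theorem nonpos_of_isLocalMax_of_hasDerivAt {φ φ' : ℝ → ℝ} {s a : ℝ} (hmax : IsLocalMax φ s)
    (hφ : ∀ᶠ t in 𝓝 s, HasDerivAt φ (φ' t) t) (hφ' : HasDerivAt φ' a s) : a ≤ 0 := by
  by_contra! ha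
  have hderiv : deriv φ =ᶠ[𝓝 s] φ' := hφ.mono fun t ht => ht.deriv
  have hderiv2 : deriv (deriv φ) s = a := by rw [hderiv.deriv_eq, hφ'.deriv]
  have hmin : IsLocalMin φ s := isLocalMin_of_deriv_deriv_pos (hderiv2 ▸ ha)
    hmax.deriv_eq_zero hφ.self_of_nhds.continuousAt
  have hconst : φ =ᶠ[𝓝 s] fun _ => φ s := by
    filter_upwards [hmax, hmin] with t hle hge using le_antisymm hle hge
  have hzero : deriv (deriv φ) s = 0 := by
    rw [hconst.deriv.deriv_eq]
    simp
  exact ha.ne' (hderiv2 ▸ hzero)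

theorem fieldDeriv_fieldDeriv_nonpos_of_isLocalMax {Z : M → M} {g : M → ℝ} {y : M}
    (hZ : ContDiffAt ℝ 1 Z y) (hline : ∀ t : ℝ, Z (y + t • Z y) = Z y)
    (hg : ContDiffAt ℝ 2 g y) (hmax : IsLocalMax g y) :
    fieldDeriv Z (fieldDeriv Z g) y ≤ 0 := by
  have hl (s : ℝ) : HasDerivAt (fun t : ℝ => y + t • Z y) (Z y) s := by
    simpa using ((hasDerivAt_id s).smul_const (Z y)).const_add y
  have hlim : Tendsto (fun t : ℝ => y + t • Z y) (𝓝 0) (𝓝 y) := by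
    simpa using (hl 0).continuousAt.tendsto
  have hderiv {f : M → ℝ} {t : ℝ} (hf : DifferentiableAt ℝ f (y + t • Z y)) :
      HasDerivAt (fun t : ℝ => f (y + t • Z y)) (fieldDeriv Z f (y + t • Z y)) t := by
    rw [fieldDeriv, hline]
    exact hf.hasFDerivAt.comp_hasDerivAt t (hl t)
  have hmax' : IsLocalMax (fun t : ℝ => g (y + t • Z y)) 0 := by
    filter_upwards [hlim.eventually hmax] with t ht
    simpa using ht
  refine nonpos_of_isLocalMax_of_hasDerivAt hmax'
    (φ' := fun t => fieldDeriv Z g (y + t • Z y)) ?_ ?_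
  · filter_upwards [hlim.eventually (hg.eventually (by simp))] with t ht
    exact hderiv (ht.differentiableAt two_ne_zero)
  · simpa using hderiv (f := fieldDeriv Z g) (t := 0)
      (by simpa using (contDiffAt_fieldDeriv hZ hg).differentiableAt one_ne_zero)

variable [Fintype ι] {Y : ι → M → M} {a : Matrix ι ι ℝ} {f g : M → ℝ} {x y : M}

/-- The second order operator `∑ a_{ij} Y_i Y_j` with frozen coefficients `a`. -/
def secondOp (Y : ι → M → M) (a : Matrix ι ι ℝ) (g : M → ℝ) (y : M) : ℝ :=
  ∑ i, ∑ j, a i j * fieldDeriv (Y i) (fieldDeriv (Y j) g) y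

theorem secondOp_add (hY : ∀ i, ContDiffAt ℝ 1 (Y i) y) (hf : ContDiffAt ℝ 2 f y)
    (hg : ContDiffAt ℝ 2 g y) : secondOp Y a (f + g) y = secondOp Y a f y + secondOp Y a g y := by
  simp only [secondOp, fieldDeriv_fieldDeriv_add (hY _) hf hg, mul_add, Finset.sum_add_distrib]

theorem secondOp_smul (ρ : ℝ) (f : M → ℝ) : secondOp Y a (ρ • f) y = ρ * secondOp Y a f y := by
  simp only [secondOp, fieldDeriv_smul, Pi.smul_apply, smul_eq_mul, Finset.mul_sum,
    mul_left_comm ρ]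

theorem secondOp_sub (hY : ∀ i, ContDiffAt ℝ 1 (Y i) y) (hf : ContDiffAt ℝ 2 f y)
    (hg : ContDiffAt ℝ 2 g y) : secondOp Y a (f - g) y = secondOp Y a f y - secondOp Y a g y := by
  have hneg : ContDiffAt ℝ 2 ((-1 : ℝ) • g) y := contDiffAt_const.smul hg
  rw [sub_eq_add_neg, ← neg_one_smul ℝ g, secondOp_add hY hf hneg, secondOp_smul]
  ring

theorem secondOp_comp {T : N → M} {Y' : ι → N → N} {y : N} {ρ : ℝ} (hT : ContDiff ℝ 1 T)
    (hY : ∀ i, ContDiffAt ℝ 1 (Y i) (T y)) (hf : ContDiffAt ℝ 2 f (T y))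
    (h : ∀ i z, fderiv ℝ T z (Y' i z) = ρ • Y i (T z)) :
    secondOp Y' a (f ∘ T) y = ρ ^ 2 * secondOp Y a f (T y) := by
  simp only [secondOp, fieldDeriv_fieldDeriv_comp hT (hY _) hf (h _) (h _), Finset.mul_sum,
    mul_left_comm (ρ ^ 2)]

theorem secondOp_conjTranspose_mul_self {κ : Type*} [Fintype κ] (b : Matrix κ ι ℝ)
    (hY : ∀ i, ContDiffAt ℝ 1 (Y i) y) (hg : ContDiffAt ℝ 2 g y) :
    secondOp Y (b.conjTranspose * b) g y =
      ∑ k, fieldDeriv (∑ i, b k i • Y i) (fieldDeriv (∑ i, b k i • Y i) g) y := by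
  have hd (j : ι) : DifferentiableAt ℝ (fieldDeriv (Y j) g) y :=
    (contDiffAt_fieldDeriv (hY j) hg).differentiableAt one_ne_zero
  simp only [secondOp, fieldDeriv_sum_smul_field, Finset.sum_apply, Pi.smul_apply, smul_eq_mul,
    fieldDeriv_sum_smul _ hd, Matrix.mul_apply, Matrix.conjTranspose_apply, star_trivial,
    Finset.sum_mul, Finset.mul_sum, mul_assoc]
  rw [eq_comm, Finset.sum_comm_cycle]
  refine Finset.sum_congr rfl fun i _ => Finset.sum_comm.trans ?_
  simp only [mul_left_comm]

open scoped MatrixOrder in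
theorem secondOp_nonpos_of_isLocalMax
    (hline : ∀ (ξ : ι → ℝ) (t : ℝ),
      (∑ i, ξ i • Y i) (y + t • (∑ i, ξ i • Y i) y) = (∑ i, ξ i • Y i) y)
    (hY : ∀ i, ContDiffAt ℝ 1 (Y i) y) (ha : a.PosSemidef) (hg : ContDiffAt ℝ 2 g y)
    (hmax : IsLocalMax g y) : secondOp Y a g y ≤ 0 := by
  classical
  obtain ⟨b, rfl⟩ := CStarAlgebra.nonneg_iff_eq_star_mul_self.1 ha.nonneg
  rw [Matrix.star_eq_conjTranspose, secondOp_conjTranspose_mul_self b hY hg]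
  refine Finset.sum_nonpos fun k _ => fieldDeriv_fieldDeriv_nonpos_of_isLocalMax
    (Z := ∑ i, b k i • Y i) ?_ (hline (b k)) hg hmax
  have hsum : (∑ i, b k i • Y i) = fun z => ∑ i, b k i • Y i z := by ext; simp
  rw [hsum]
  exact ContDiffAt.sum fun i _ => contDiffAt_const.smul (hY i)

variable {O : Set (M × N)} {F : M → N → ℝ}

theorem contDiffOn_fieldDeriv_prod {X : M → M} (hO : IsOpen O) (hX : ContDiff ℝ 1 X)
    (hF : ContDiffOn ℝ 2 (fun t : M × N => F t.1 t.2) O) :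
    ContDiffOn ℝ 1 (fun t : M × N => fieldDeriv X (fun z => F z t.2) t.1) O :=
  (contDiffOn_partialFDeriv hO one_add_one_eq_two.le hF).clm_apply
    (hX.comp contDiff_fst).contDiffOn

variable {K : Set N} [MeasurableSpace N] [OpensMeasurableSpace N] {μ : Measure N}
  [IsFiniteMeasureOnCompacts μ]

theorem fieldDeriv_setIntegral {X : M → M} (hO : IsOpen O)
    (hF : ContDiffOn ℝ 1 (fun t : M × N => F t.1 t.2) O) (hK : IsCompact K)
    (hx : ∀ e ∈ K, (x, e) ∈ O) :
    fieldDeriv X (fun z => ∫ e in K, F z e ∂μ) x =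
      ∫ e in K, fieldDeriv X (fun z => F z e) x ∂μ := by
  rw [fieldDeriv, (hasFDerivAt_setIntegral_of_contDiffOn hO hF hK hx).fderiv,
    ContinuousLinearMap.integral_apply]
  · rfl
  · exact integrableOn_of_continuousOn_prod
      (contDiffOn_partialFDeriv (j := 0) hO (by simp) hF).continuousOn hK hx

theorem secondOp_setIntegral (hY : ∀ i, ContDiff ℝ 1 (Y i)) (hO : IsOpen O)
    (hF : ContDiffOn ℝ 2 (fun t : M × N => F t.1 t.2) O) (hK : IsCompact K)
    (hx : ∀ e ∈ K, (x, e) ∈ O) :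
    secondOp Y a (fun z => ∫ e in K, F z e ∂μ) x =
      ∫ e in K, secondOp Y a (fun z => F z e) x ∂μ := by
  have hfirst (j : ι) : fieldDeriv (Y j) (fun z => ∫ e in K, F z e ∂μ) =ᶠ[𝓝 x]
      fun z => ∫ e in K, fieldDeriv (Y j) (fun z => F z e) z ∂μ := by
    filter_upwards [(isOpen_setOf_forall_prodMk_mem hO hK).mem_nhds hx] with z hz
    exact fieldDeriv_setIntegral hO (hF.of_le one_le_two) hK hz
  have hsecond (i j : ι) : fieldDeriv (Y i) (fieldDeriv (Y j) fun z => ∫ e in K, F z e ∂μ) x =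
      ∫ e in K, fieldDeriv (Y i) (fieldDeriv (Y j) fun z => F z e) x ∂μ := by
    rw [fieldDeriv_congr (hfirst j)]
    exact fieldDeriv_setIntegral hO (contDiffOn_fieldDeriv_prod hO (hY j) hF) hK hx
  have hint (i j : ι) :
      IntegrableOn (fun e => a i j * fieldDeriv (Y i) (fieldDeriv (Y j) fun z => F z e) x) K μ := by
    refine Integrable.const_mul ?_ (a i j)
    have hcont := (contDiffOn_partialFDeriv (j := 0) (k := 1) hO (by simp)
      (F := fun z e => fieldDeriv (Y j) (fun z => F z e) z)
      (contDiffOn_fieldDeriv_prod hO (hY j) hF)).continuousOn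
    exact (integrableOn_of_continuousOn_prod hcont hK hx).apply_continuousLinearMap (Y i x)
  simp only [secondOp, hsecond]
  rw [integral_finsetSum _ fun i _ => integrable_finsetSum _ fun j _ => hint i j]
  simp only [integral_finsetSum _ fun j _ => hint _ j, integral_const_mul]

end MaximumPrinciple

section Model

open ContinuousLinearMap Module

section Gauge

variable {V W : Type*} [NormedAddCommGroup V] [NormedAddCommGroup W]

/-- The fourth power of the homogeneous norm of `V × W`, where `V` has weight `1` and `W` has
weight `2`. -/
def gauge (y : V × W) : ℝ := ‖y.1‖ ^ 4 + 16 * ‖y.2‖ ^ 2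

variable (V W) in
/-- The open ball of radius `r` about the origin for the homogeneous norm. -/
def openGaugeBall (r : ℝ) : Set (V × W) := {y | gauge y < r ^ 4}

variable (V W) in
/-- The closed ball of radius `r` about the origin for the homogeneous norm. -/
def closedGaugeBall (r : ℝ) : Set (V × W) := {y | gauge y ≤ r ^ 4}

theorem mem_closedGaugeBall_one {y : V × W} : y ∈ closedGaugeBall V W 1 ↔ gauge y ≤ 1 := by
  rw [closedGaugeBall, one_pow, Set.mem_ofPred_eq]

theorem gauge_nonneg (y : V × W) : 0 ≤ gauge y := by
  unfold gauge
  positivity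

@[simp]
theorem gauge_zero : gauge (0 : V × W) = 0 := by simp [gauge]

@[simp]
theorem gauge_neg (y : V × W) : gauge (-y) = gauge y := by simp [gauge]

theorem norm_fst_le_of_gauge_le {r : ℝ} (hr : 0 ≤ r) {y : V × W} (hy : gauge y ≤ r ^ 4) :
    ‖y.1‖ ≤ r :=
  le_of_pow_le_pow_left₀ four_ne_zero hr
    ((le_add_of_nonneg_right (by positivity)).trans
      (show ‖y.1‖ ^ 4 + 16 * ‖y.2‖ ^ 2 ≤ r ^ 4 from hy))

theorem norm_snd_le_of_gauge_le {r : ℝ} {y : V × W} (hy : gauge y ≤ r ^ 4) : ‖y.2‖ ≤ r ^ 2 := by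
  refine le_of_pow_le_pow_left₀ two_ne_zero (sq_nonneg r) ?_
  unfold gauge at hy
  nlinarith [sq_nonneg ‖y.2‖, pow_nonneg (norm_nonneg y.1) 4]

@[simp]
theorem gauge_eq_zero {y : V × W} : gauge y = 0 ↔ y = 0 := by
  refine ⟨fun h => ?_, fun h => h ▸ gauge_zero⟩
  have hle : gauge y ≤ 0 ^ 4 := by simp [h]
  ext1
  · exact norm_le_zero_iff.1 (norm_fst_le_of_gauge_le le_rfl hle)
  · simpa using norm_snd_le_of_gauge_le hle

theorem gauge_pos {y : V × W} : 0 < gauge y ↔ y ≠ 0 := by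
  rw [(gauge_nonneg y).lt_iff_ne', Ne, gauge_eq_zero]

theorem openGaugeBall_subset_closedGaugeBall (r : ℝ) :
    openGaugeBall V W r ⊆ closedGaugeBall V W r :=
  fun y (hy : gauge y < r ^ 4) => hy.le

theorem openGaugeBall_subset_openGaugeBall {r s : ℝ} (hr : 0 ≤ r) (hrs : r ≤ s) :
    openGaugeBall V W r ⊆ openGaugeBall V W s :=
  fun _ hy => lt_of_lt_of_le hy (pow_le_pow_left₀ hr hrs 4)

theorem closedGaugeBall_subset_closedGaugeBall {r s : ℝ} (hr : 0 ≤ r) (hrs : r ≤ s) :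
    closedGaugeBall V W r ⊆ closedGaugeBall V W s :=
  fun _ hy => le_trans hy (pow_le_pow_left₀ hr hrs 4)

theorem continuous_gauge : Continuous (gauge : V × W → ℝ) := by
  unfold gauge
  fun_prop

theorem isOpen_openGaugeBall (r : ℝ) : IsOpen (openGaugeBall V W r) :=
  isOpen_lt continuous_gauge continuous_const

theorem isClosed_closedGaugeBall (r : ℝ) : IsClosed (closedGaugeBall V W r) :=
  isClosed_le continuous_gauge continuous_const

end Gauge

section Law

variable {V W : Type*} [NormedAddCommGroup V] [NormedSpace ℝ V] [NormedAddCommGroup W]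
  [NormedSpace ℝ W]

/-- The anisotropic dilation of `V × W` of ratio `r`. -/
def dilate (r : ℝ) (y : V × W) : V × W := (r • y.1, r ^ 2 • y.2)

/-- The group law on `V × W` in exponential coordinates, for the step two Lie algebra with bracket
`b : V × V → W` and center containing `W`. -/
def stepTwoMul (b : V →L[ℝ] V →L[ℝ] W) (x y : V × W) : V × W :=
  (x.1 + y.1, x.2 + y.2 + (1 / 2 : ℝ) • b x.1 y.1)

/-- The vector field, left invariant under `stepTwoMul b`, with value `(ξ, 0)` at the origin. -/
def leftField (b : V →L[ℝ] V →L[ℝ] W) (ξ : V) (y : V × W) : V × W := (ξ, (1 / 2 : ℝ) • b y.1 ξ)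

theorem gauge_dilate (r : ℝ) (y : V × W) : gauge (dilate r y) = r ^ 4 * gauge y := by
  simp only [gauge, dilate, norm_smul, mul_pow, norm_pow, Real.norm_eq_abs, ← abs_pow, ← pow_mul,
    abs_of_nonneg (Even.pow_nonneg (by decide : Even 4) r)]
  ring

theorem contDiff_dilate (r : ℝ) {k : WithTop ℕ∞} : ContDiff ℝ k (dilate r : V × W → V × W) := by
  unfold dilate
  fun_prop

@[simp]
theorem dilate_zero (r : ℝ) : dilate r (0 : V × W) = 0 := by simp [dilate]

theorem preimage_dilate_closedGaugeBall {r : ℝ} (hr : 0 < r) (s : ℝ) :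
    dilate r ⁻¹' closedGaugeBall V W (r * s) = closedGaugeBall V W s := by
  ext y
  simp only [closedGaugeBall, Set.mem_preimage, Set.mem_ofPred_eq, gauge_dilate, mul_pow]
  exact mul_le_mul_iff_right₀ (by positivity)

theorem bijective_dilate {r : ℝ} (hr : 0 < r) :
    Function.Bijective (dilate r : V × W → V × W) :=
  Function.bijective_iff_has_inverse.2 ⟨dilate r⁻¹,
    fun y => by simp [dilate, hr.ne'], fun y => by simp [dilate, hr.ne']⟩

theorem image_dilate_openGaugeBall {r : ℝ} (hr : 0 < r) (s : ℝ) :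
    dilate r '' openGaugeBall V W s = openGaugeBall V W (r * s) := by
  have hpreimage : dilate r ⁻¹' openGaugeBall V W (r * s) = openGaugeBall V W s := by
    ext y
    simp only [openGaugeBall, Set.mem_preimage, Set.mem_ofPred_eq, gauge_dilate, mul_pow]
    exact mul_lt_mul_iff_right₀ (by positivity)
  rw [← hpreimage, Set.image_preimage_eq _ (bijective_dilate hr).surjective]

variable (b : V →L[ℝ] V →L[ℝ] W)

theorem contDiff_stepTwoMul {k : WithTop ℕ∞} :
    ContDiff ℝ k fun t : (V × W) × (V × W) => stepTwoMul b t.1 t.2 := by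
  unfold stepTwoMul
  fun_prop

theorem contDiff_stepTwoMul_left (x : V × W) {k : WithTop ℕ∞} : ContDiff ℝ k (stepTwoMul b x) :=
  (contDiff_stepTwoMul b).comp (contDiff_prodMk_right x)

theorem contDiff_leftField (ξ : V) {k : WithTop ℕ∞} : ContDiff ℝ k (leftField b ξ) := by
  unfold leftField
  fun_prop

theorem continuous_uncurry_stepTwoMul :
    Continuous fun t : (V →L[ℝ] V →L[ℝ] W) × (V × W) × (V × W) =>
      stepTwoMul t.1 t.2.1 t.2.2 := by
  unfold stepTwoMul
  fun_prop

@[simp]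
theorem stepTwoMul_zero (x : V × W) : stepTwoMul b x 0 = x := by simp [stepTwoMul]

@[simp]
theorem zero_stepTwoMul (x : V × W) : stepTwoMul b 0 x = x := by simp [stepTwoMul]

theorem stepTwoMul_assoc (x y z : V × W) :
    stepTwoMul b (stepTwoMul b x y) z = stepTwoMul b x (stepTwoMul b y z) := by
  simp only [stepTwoMul, map_add, add_apply, smul_add, Prod.mk.injEq]
  exact ⟨by abel, by abel⟩

theorem sum_smul_leftField {ι : Type*} [Fintype ι] (s : ι → ℝ) (ξ : ι → V) :
    ∑ i, s i • leftField b (ξ i) = leftField b (∑ i, s i • ξ i) := by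
  ext1 y
  simp [leftField, Prod.ext_iff, Prod.fst_sum, Prod.snd_sum, Finset.smul_sum, smul_comm (s _)]

theorem fderiv_stepTwoMul_leftField (x : V × W) (ξ : V) (y : V × W) :
    fderiv ℝ (stepTwoMul b x) y (leftField b ξ y) = leftField b ξ (stepTwoMul b x y) := by
  have hfst : HasFDerivAt (fun z : V × W => x.1 + z.1) (fst ℝ V W) y :=
    (fst ℝ V W).hasFDerivAt.const_add x.1
  have hsnd : HasFDerivAt (fun z : V × W => x.2 + z.2 + (1 / 2 : ℝ) • b x.1 z.1)
      (snd ℝ V W + (1 / 2 : ℝ) • (b x.1).comp (fst ℝ V W)) y :=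
    ((snd ℝ V W).hasFDerivAt.const_add x.2).add
      (((b x.1).comp (fst ℝ V W)).hasFDerivAt.const_smul (1 / 2 : ℝ))
  have h : HasFDerivAt (stepTwoMul b x) _ y := hfst.prodMk hsnd
  rw [h.fderiv]
  simp [leftField, stepTwoMul, add_comm]

theorem fderiv_dilate_leftField (r : ℝ) (ξ : V) (y : V × W) :
    fderiv ℝ (dilate r) y (leftField b ξ y) = r • leftField b ξ (dilate r y) := by
  have h : HasFDerivAt (dilate r) ((r • fst ℝ V W).prod (r ^ 2 • snd ℝ V W)) y :=
    ((fst ℝ V W).hasFDerivAt.const_smul r).prodMk ((snd ℝ V W).hasFDerivAt.const_smul (r ^ 2))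
  rw [h.fderiv]
  simp [leftField, dilate, smul_smul, pow_two, mul_assoc, mul_comm r 2⁻¹]

theorem fderiv_stepTwoMul_dilate_leftField (x : V × W) (r : ℝ) (ξ : V) (y : V × W) :
    fderiv ℝ (stepTwoMul b x ∘ dilate r) y (leftField b ξ y) =
      r • leftField b ξ ((stepTwoMul b x ∘ dilate r) y) := by
  rw [fderiv_comp y
    ((contDiff_stepTwoMul_left b x (k := 1)).contDiffAt.differentiableAt one_ne_zero)
    ((contDiff_dilate r (k := 1)).contDiffAt.differentiableAt one_ne_zero),
    ContinuousLinearMap.comp_apply, fderiv_dilate_leftField, map_smul,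
    fderiv_stepTwoMul_leftField, Function.comp_apply]

end Law

variable {V W : Type*} [NormedAddCommGroup V] [InnerProductSpace ℝ V] [NormedAddCommGroup W]
  [InnerProductSpace ℝ W]

theorem contDiff_gauge {k : WithTop ℕ∞} : ContDiff ℝ k (gauge : V × W → ℝ) := by
  have h (y : V × W) : gauge y = (‖y.1‖ ^ 2) ^ 2 + 16 * ‖y.2‖ ^ 2 := by
    unfold gauge
    ring
  rw [funext h]
  exact ((contDiff_fst.norm_sq ℝ).pow 2).add (contDiff_const.mul (contDiff_snd.norm_sq ℝ))

section HTypeBracket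

variable [CompleteSpace V] [CompleteSpace W] {b : V →L[ℝ] V →L[ℝ] W}

/-- The bracket `b : V × V → W` of an algebra of H-type with center `W`. The operator
`J_z : V → V` of the H-type condition is `v ↦ (b v)† z`. -/
structure IsHTypeBracket (b : V →L[ℝ] V →L[ℝ] W) : Prop where
  self_eq_zero : ∀ v, b v v = 0
  norm_adjoint_apply : ∀ v z, ‖adjoint (b v) z‖ = ‖v‖ * ‖z‖

namespace IsHTypeBracket

variable (hb : IsHTypeBracket b)
include hb

theorem antisymm (v w : V) : b v w = -b w v := by
  have h := hb.self_eq_zero (v + w)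
  simp only [map_add, add_apply, hb.self_eq_zero, zero_add, add_zero] at h
  exact eq_neg_of_add_eq_zero_right h

theorem norm_le_one : ‖b‖ ≤ 1 :=
  opNorm_le_bound _ zero_le_one fun v => by
    rw [one_mul, ← LinearIsometryEquiv.norm_map adjoint (b v)]
    exact opNorm_le_bound _ (norm_nonneg v) fun z => (hb.norm_adjoint_apply v z).le

theorem stepTwoMul_neg_self (x : V × W) : stepTwoMul b x (-x) = 0 := by
  simp [stepTwoMul, hb.self_eq_zero]

theorem neg_stepTwoMul_neg (x y : V × W) : -stepTwoMul b (-x) y = stepTwoMul b (-y) x := by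
  simp [stepTwoMul, hb.antisymm y.1 x.1, add_comm]

theorem gauge_stepTwoMul_neg_comm (x y : V × W) :
    gauge (stepTwoMul b (-x) y) = gauge (stepTwoMul b (-y) x) := by
  rw [← hb.neg_stepTwoMul_neg, gauge_neg]

theorem stepTwoMul_neg_eq_zero {x y : V × W} : stepTwoMul b (-x) y = 0 ↔ y = x := by
  refine ⟨fun h => ?_, ?_⟩
  · have h' := congrArg (stepTwoMul b x) h
    rwa [← stepTwoMul_assoc, hb.stepTwoMul_neg_self, zero_stepTwoMul, stepTwoMul_zero] at h'
  · rintro rfl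
    simpa using hb.stepTwoMul_neg_self (-y)

theorem leftField_add_smul (ξ : V) (y : V × W) (t : ℝ) :
    leftField b ξ (y + t • leftField b ξ y) = leftField b ξ y := by
  simp [leftField, hb.self_eq_zero]

end IsHTypeBracket

/-- The neighbourhood of the origin does not depend on the bracket, because the H-type brackets
form a bounded set. -/
theorem exists_forall_closedGaugeBall_lt [FiniteDimensional ℝ V] [FiniteDimensional ℝ W]
    {F : (V →L[ℝ] V →L[ℝ] W) × (V × W) × (V × W) → ℝ} (hF : Continuous F) {K : Set (V × W)}
    (hK : IsCompact K) {a : ℝ} (h0 : ∀ b, ∀ x ∈ K, F (b, x, 0) < a) :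
    ∃ r : ℝ, 0 < r ∧ r ≤ 1 ∧ ∀ b, IsHTypeBracket b → ∀ x ∈ K, ∀ y ∈ closedGaugeBall V W r,
      F (b, x, y) < a := by
  have := FiniteDimensional.proper_real (V →L[ℝ] V →L[ℝ] W)
  have hnear : ∀ᶠ y in 𝓝 (0 : V × W),
      ∀ t ∈ Metric.closedBall (0 : V →L[ℝ] V →L[ℝ] W) 1 ×ˢ K, F (t.1, t.2, y) < a := by
    refine ((isCompact_closedBall _ 1).prod hK).eventually_forall_of_forall_eventually ?_
    rintro ⟨b, x⟩ ⟨-, hx⟩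
    exact (hF.comp (f := fun z : (V × W) × (V →L[ℝ] V →L[ℝ] W) × (V × W) => (z.2.1, z.2.2, z.1))
      (by fun_prop)).continuousAt.eventually_lt_const (h0 b x hx)
  obtain ⟨ρ, hρ, hball⟩ := Metric.eventually_nhds_iff.1 hnear
  refine ⟨min (ρ / 2) 1, by positivity, min_le_right _ _, fun b hb x hx y hy =>
    hball ?_ (b, x) ⟨(dist_zero_right b).trans_le hb.norm_le_one, hx⟩⟩
  have hfst := norm_fst_le_of_gauge_le (by positivity) hy
  have hsnd := (norm_snd_le_of_gauge_le hy).trans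
    (pow_le_of_le_one (by positivity) (min_le_right _ _) two_ne_zero)
  rw [dist_zero_right]
  exact (max_le hfst hsnd).trans_lt ((min_le_left _ _).trans_lt (half_lt_self hρ))

end HTypeBracket

section Measure

variable (V W) in
/-- The homogeneous dimension of `V × W`. -/
def homDim : ℕ := finrank ℝ V + 2 * finrank ℝ W

theorem isCompact_closedGaugeBall [FiniteDimensional ℝ V] [FiniteDimensional ℝ W] {r : ℝ}
    (hr : 0 ≤ r) : IsCompact (closedGaugeBall V W r) := by
  have hball : closedGaugeBall V W r ⊆
      Metric.closedBall (0 : V) r ×ˢ Metric.closedBall (0 : W) (r ^ 2) := fun y hy => by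
    simpa using And.intro (norm_fst_le_of_gauge_le hr hy) (norm_snd_le_of_gauge_le hy)
  have := FiniteDimensional.proper_real V
  have := FiniteDimensional.proper_real W
  exact ((isCompact_closedBall _ _).prod (isCompact_closedBall _ _)).of_isClosed_subset
    (isClosed_closedGaugeBall r) hball

variable [FiniteDimensional ℝ V] [MeasurableSpace V] [BorelSpace V]
  [FiniteDimensional ℝ W] [MeasurableSpace W] [BorelSpace W]

theorem measurePreserving_stepTwoMul_left (b : V →L[ℝ] V →L[ℝ] W) (x : V × W) :
    MeasurePreserving (stepTwoMul b x) := by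
  have hshear : stepTwoMul b x =
      fun y => (x.1 + y.1, x.2 + (1 / 2 : ℝ) • b x.1 y.1 + y.2) := by
    ext1 y
    simp only [stepTwoMul, add_right_comm]
  rw [hshear]
  exact (measurePreserving_add_left volume x.1).skew_product
    (g := fun p q => x.2 + (1 / 2 : ℝ) • b x.1 p + q) (by fun_prop)
    (ae_of_all _ fun p => (measurePreserving_add_left volume _).map_eq)

theorem map_dilate_volume {r : ℝ} (hr : 0 < r) :
    Measure.map (dilate r) (volume : Measure (V × W)) =
      ENNReal.ofReal ((r ^ homDim V W)⁻¹) • volume := by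
  have hprod : (dilate r : V × W → V × W) = Prod.map (r • ·) (r ^ 2 • ·) := rfl
  rw [hprod, Measure.volume_eq_prod, ← Measure.map_prod_map _ _ (by fun_prop) (by fun_prop),
    Measure.map_addHaar_smul _ hr.ne', Measure.map_addHaar_smul _ (pow_pos hr 2).ne',
    Measure.prod_smul_left, Measure.prod_smul_right, smul_smul,
    ← ENNReal.ofReal_mul (by positivity), abs_of_pos (by positivity), abs_of_pos (by positivity),
    homDim, pow_add, pow_mul r 2, mul_inv]

theorem volume_preimage_dilate {r : ℝ} (hr : 0 < r) {s : Set (V × W)} (hs : MeasurableSet s) :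
    volume (dilate r ⁻¹' s) = ENNReal.ofReal ((r ^ homDim V W)⁻¹) * volume s := by
  rw [← Measure.map_apply (contDiff_dilate r (k := 0)).continuous.measurable hs,
    map_dilate_volume hr, Measure.smul_apply, smul_eq_mul]

theorem volume_closedGaugeBall {r : ℝ} (hr : 0 < r) :
    volume (closedGaugeBall V W r) =
      ENNReal.ofReal (r ^ homDim V W) * volume (closedGaugeBall V W 1) := by
  have h := volume_preimage_dilate hr
    (isClosed_closedGaugeBall (V := V) (W := W) (r * 1)).measurableSet
  rw [preimage_dilate_closedGaugeBall hr, mul_one] at h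
  rw [h, ← mul_assoc, ← ENNReal.ofReal_mul (by positivity), mul_inv_cancel₀ (by positivity),
    ENNReal.ofReal_one, one_mul]

theorem measureReal_closedGaugeBall {r : ℝ} (hr : 0 < r) :
    volume.real (closedGaugeBall V W r) =
      r ^ homDim V W * volume.real (closedGaugeBall V W 1) := by
  rw [measureReal_def, volume_closedGaugeBall hr, ENNReal.toReal_mul,
    ENNReal.toReal_ofReal (by positivity), measureReal_def]

theorem volume_closedGaugeBall_ne_top {r : ℝ} (hr : 0 ≤ r) :
    volume (closedGaugeBall V W r) ≠ ⊤ :=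
  (isCompact_closedGaugeBall hr).measure_ne_top

theorem volume_openGaugeBall_pos {r : ℝ} (hr : 0 < r) : 0 < volume (openGaugeBall V W r) :=
  (isOpen_openGaugeBall r).measure_pos volume
    ⟨0, by simpa [openGaugeBall] using pow_pos hr 4⟩

end Measure

end Model

section Barrier

open ContinuousLinearMap Module

variable {V W ι : Type*} [NormedAddCommGroup V] [InnerProductSpace ℝ V] [NormedAddCommGroup W]
  [InnerProductSpace ℝ W]

theorem contDiffAt_gauge_rpow (s : ℝ) {y : V × W} (hy : y ≠ 0) {k : WithTop ℕ∞} :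
    ContDiffAt ℝ k (fun z : V × W => gauge z ^ s) y :=
  contDiff_gauge.contDiffAt.rpow_const_of_ne (gauge_pos.2 hy).ne'

variable [Fintype ι]

theorem mulVec_dotProduct_self (a : Matrix ι ι ℝ) (ξ : ι → ℝ) :
    a.mulVec ξ ⬝ᵥ ξ = ∑ i, ∑ j, a i j * (ξ i * ξ j) := by
  simp only [dotProduct, Matrix.mulVec, Finset.sum_mul]
  exact Finset.sum_congr rfl fun i _ => Finset.sum_congr rfl fun j _ => by ring

theorem sum_sum_mul_eq_zero_of_isSymm {a : Matrix ι ι ℝ} (ha : a.IsSymm) {s : ι → ι → ℝ}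
    (hs : ∀ i j, s i j = -s j i) : ∑ i, ∑ j, a i j * s i j = 0 := by
  have h : ∑ i, ∑ j, a i j * s i j = -∑ i, ∑ j, a i j * s i j := by
    conv_lhs => rw [Finset.sum_comm]
    simp only [← Finset.sum_neg_distrib]
    exact Finset.sum_congr rfl fun i _ => Finset.sum_congr rfl fun j _ => by
      rw [ha.apply, hs, mul_neg]
  linarith

variable (e : OrthonormalBasis ι ℝ V)

theorem dotProduct_inner_basis_self (v : V) : (⟪v, e ·⟫_ℝ) ⬝ᵥ (⟪v, e ·⟫_ℝ) = ‖v‖ ^ 2 := by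
  simp only [dotProduct, ← pow_two, e.sum_sq_inner_left]

theorem sum_sum_mul_inner_basis (a : Matrix ι ι ℝ) :
    ∑ i, ∑ j, a i j * ⟪e i, e j⟫_ℝ = a.trace := by
  classical
  simp [e.inner_eq_ite, Matrix.trace]

theorem secondOp_norm_fst_sq (b : V →L[ℝ] V →L[ℝ] W) (a : Matrix ι ι ℝ) (y : V × W) :
    secondOp (fun i => leftField b (e i)) a (fun z => ‖z.1‖ ^ 2) y = 2 * a.trace := by
  have hfirst (ξ : V) : fieldDeriv (leftField b ξ) (fun z : V × W => ‖z.1‖ ^ 2) =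
      (2 : ℝ) • fun z => ⟪z.1, ξ⟫_ℝ := by
    ext1 z
    rw [fieldDeriv, (hasFDerivAt_fst.norm_sq (x := z)).fderiv]
    simp [leftField]
  have hsecond (ξ η : V) : fieldDeriv (leftField b ξ) (fun z : V × W => ⟪z.1, η⟫_ℝ) y =
      ⟪ξ, η⟫_ℝ := by
    rw [fieldDeriv, (hasFDerivAt_fst.inner ℝ (hasFDerivAt_const η y)).fderiv]
    simp [leftField]
  simp only [secondOp, hfirst, fieldDeriv_smul, Pi.smul_apply, hsecond, smul_eq_mul,
    mul_left_comm _ (2 : ℝ), ← Finset.mul_sum, sum_sum_mul_inner_basis]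

variable [CompleteSpace V] [CompleteSpace W] {a : Matrix ι ι ℝ} {b : V →L[ℝ] V →L[ℝ] W}

/-- The horizontal gradient of the gauge for the left-invariant fields of `b`, where
`adjoint (b v) z` is `J_z v`. -/
def gaugeGradient (b : V →L[ℝ] V →L[ℝ] W) (y : V × W) : V :=
  (4 * ‖y.1‖ ^ 2) • y.1 + (16 : ℝ) • adjoint (b y.1) y.2

theorem inner_gaugeGradient (y : V × W) (ξ : V) :
    ⟪gaugeGradient b y, ξ⟫_ℝ = 4 * ‖y.1‖ ^ 2 * ⟪y.1, ξ⟫_ℝ + 16 * ⟪y.2, b y.1 ξ⟫_ℝ := by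
  simp only [gaugeGradient, inner_add_left, real_inner_smul_left, adjoint_inner_left]

theorem fieldDeriv_gauge (ξ : V) (y : V × W) :
    fieldDeriv (leftField b ξ) gauge y = ⟪gaugeGradient b y, ξ⟫_ℝ := by
  have hfst : HasFDerivAt (fun z : V × W => ‖z.1‖ ^ 4) _ y :=
    ((hasFDerivAt_fst.norm_sq (x := y)).pow 2).congr_of_eventuallyEq
      (.of_forall fun z => by simp [← pow_mul])
  have h : HasFDerivAt (gauge : V × W → ℝ) _ y :=
    hfst.add ((hasFDerivAt_snd.norm_sq (x := y)).const_mul 16)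
  rw [fieldDeriv, h.fderiv, inner_gaugeGradient]
  simp [leftField]
  ring

theorem fieldDeriv_inner_gaugeGradient (ξ η : V) (y : V × W) :
    fieldDeriv (leftField b ξ) (fun z => ⟪gaugeGradient b z, η⟫_ℝ) y =
      8 * (⟪y.1, ξ⟫_ℝ * ⟪y.1, η⟫_ℝ) + 4 * ‖y.1‖ ^ 2 * ⟪ξ, η⟫_ℝ +
        8 * ⟪b y.1 ξ, b y.1 η⟫_ℝ + 16 * ⟪y.2, b ξ η⟫_ℝ := by
  have hfst : HasFDerivAt (fun z : V × W => ⟪z.1, η⟫_ℝ) _ y :=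
    hasFDerivAt_fst.inner ℝ (hasFDerivAt_const η y)
  have hb : HasFDerivAt (fun z : V × W => b z.1 η) ((b.flip η).comp (fst ℝ V W)) y :=
    ((b.flip η).comp (fst ℝ V W)).hasFDerivAt
  have h := (((hasFDerivAt_fst.norm_sq (x := y)).const_mul 4).mul hfst).add
    ((hasFDerivAt_snd.inner ℝ hb).const_mul 16)
  have hgrad : (fun z => ⟪gaugeGradient b z, η⟫_ℝ) =
      (fun z : V × W => 4 * ‖z.1‖ ^ 2) * (fun z => ⟪z.1, η⟫_ℝ) +
        fun z => 16 * ⟪z.2, b z.1 η⟫_ℝ := funext fun z => inner_gaugeGradient z η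
  rw [fieldDeriv, hgrad, h.fderiv]
  simp [leftField, inner_smul_left]
  ring

theorem contDiff_inner_gaugeGradient (η : V) {k : WithTop ℕ∞} :
    ContDiff ℝ k fun y : V × W => ⟪gaugeGradient b y, η⟫_ℝ := by
  simp only [inner_gaugeGradient]
  exact ((contDiff_const.mul (contDiff_fst.norm_sq ℝ)).mul
    (contDiff_fst.inner ℝ contDiff_const)).add (contDiff_const.mul
      (contDiff_snd.inner ℝ ((b.contDiff.comp contDiff_fst).clm_apply contDiff_const)))

theorem IsHTypeBracket.norm_sq_gaugeGradient (hb : IsHTypeBracket b) (y : V × W) :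
    ‖gaugeGradient b y‖ ^ 2 = 16 * ‖y.1‖ ^ 2 * gauge y := by
  have horth : ⟪y.1, adjoint (b y.1) y.2⟫_ℝ = 0 := by
    rw [adjoint_inner_right, hb.self_eq_zero, inner_zero_left]
  rw [gaugeGradient, norm_add_sq_real, real_inner_smul_left, real_inner_smul_right, horth,
    norm_smul, norm_smul, hb.norm_adjoint_apply, mul_pow, mul_pow, mul_pow, Real.norm_eq_abs,
    Real.norm_eq_abs, sq_abs, sq_abs, gauge]
  ring

theorem IsHTypeBracket.sum_mul_inner_bracket_le [FiniteDimensional ℝ W] (hb : IsHTypeBracket b)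
    {hi : ℝ} (hhi : ∀ ξ, a.mulVec ξ ⬝ᵥ ξ ≤ hi * (ξ ⬝ᵥ ξ)) (p : V) :
    ∑ i, ∑ j, a i j * ⟪b p (e i), b p (e j)⟫_ℝ ≤ finrank ℝ W * (hi * ‖p‖ ^ 2) := by
  set f := stdOrthonormalBasis ℝ W
  have hexpand (i j : ι) : ⟪b p (e i), b p (e j)⟫_ℝ =
      ∑ k, ⟪adjoint (b p) (f k), e i⟫_ℝ * ⟪adjoint (b p) (f k), e j⟫_ℝ := by
    simp only [adjoint_inner_left]
    rw [← f.sum_inner_mul_inner]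
    exact Finset.sum_congr rfl fun k _ => by rw [real_inner_comm]
  calc ∑ i, ∑ j, a i j * ⟪b p (e i), b p (e j)⟫_ℝ
      = ∑ k, a.mulVec (⟪adjoint (b p) (f k), e ·⟫_ℝ) ⬝ᵥ (⟪adjoint (b p) (f k), e ·⟫_ℝ) := by
        simp only [mulVec_dotProduct_self, hexpand, Finset.mul_sum]
        exact Finset.sum_comm_cycle
    _ ≤ ∑ _k : Fin (finrank ℝ W), hi * ‖p‖ ^ 2 := Finset.sum_le_sum fun k _ => by
        simpa [dotProduct_inner_basis_self, hb.norm_adjoint_apply] using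
          hhi (⟪adjoint (b p) (f k), e ·⟫_ℝ)
    _ = finrank ℝ W * (hi * ‖p‖ ^ 2) := by simp

theorem IsHTypeBracket.sum_mul_fieldDeriv_gaugeGradient_le [FiniteDimensional ℝ W]
    (hb : IsHTypeBracket b) (ha : a.IsSymm) {hi : ℝ}
    (hhi : ∀ ξ, a.mulVec ξ ⬝ᵥ ξ ≤ hi * (ξ ⬝ᵥ ξ)) (y : V × W) :
    ∑ i, ∑ j, a i j * fieldDeriv (leftField b (e i)) (fun z => ⟪gaugeGradient b z, e j⟫_ℝ) y ≤
      4 * ‖y.1‖ ^ 2 * (a.trace + (2 * finrank ℝ W + 2) * hi) := by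
  have hquad := hhi (⟪y.1, e ·⟫_ℝ)
  rw [dotProduct_inner_basis_self, mulVec_dotProduct_self] at hquad
  have hbracket := hb.sum_mul_inner_bracket_le e hhi y.1
  have hskew : ∑ i, ∑ j, a i j * ⟪y.2, b (e i) (e j)⟫_ℝ = 0 :=
    sum_sum_mul_eq_zero_of_isSymm ha fun i j => by rw [hb.antisymm, inner_neg_right]
  calc _ = 8 * (∑ i, ∑ j, a i j * (⟪y.1, e i⟫_ℝ * ⟪y.1, e j⟫_ℝ)) + 4 * ‖y.1‖ ^ 2 * a.trace +
        8 * (∑ i, ∑ j, a i j * ⟪b y.1 (e i), b y.1 (e j)⟫_ℝ) +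
        16 * ∑ i, ∑ j, a i j * ⟪y.2, b (e i) (e j)⟫_ℝ := by
        simp only [fieldDeriv_inner_gaugeGradient, mul_add, Finset.sum_add_distrib,
          mul_left_comm (a _ _), ← Finset.mul_sum, sum_sum_mul_inner_basis]
    _ ≤ _ := by linarith

theorem fieldDeriv_gauge_rpow (s : ℝ) (ξ : V) {y : V × W} (hy : y ≠ 0) :
    fieldDeriv (leftField b ξ) (fun z => gauge z ^ s) y =
      s * gauge y ^ (s - 1) * ⟪gaugeGradient b y, ξ⟫_ℝ := by
  have h := (contDiff_gauge.differentiable one_ne_zero y).hasFDerivAt.rpow_const (p := s)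
    (Or.inl (gauge_pos.2 hy).ne')
  rw [fieldDeriv, h.fderiv, ← fieldDeriv_gauge, fieldDeriv, smul_apply, smul_eq_mul]

theorem fieldDeriv_fieldDeriv_gauge_rpow (s : ℝ) (ξ η : V) {y : V × W} (hy : y ≠ 0) :
    fieldDeriv (leftField b ξ) (fieldDeriv (leftField b η) fun z => gauge z ^ s) y =
      s * gauge y ^ (s - 2) *
        ((s - 1) * (⟪gaugeGradient b y, ξ⟫_ℝ * ⟪gaugeGradient b y, η⟫_ℝ) +
          gauge y * fieldDeriv (leftField b ξ) (fun z => ⟪gaugeGradient b z, η⟫_ℝ) y) := by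
  have hfirst : fieldDeriv (leftField b η) (fun z => gauge z ^ s) =ᶠ[𝓝 y]
      s • ((fun z => gauge z ^ (s - 1)) * fun z => ⟪gaugeGradient b z, η⟫_ℝ) := by
    filter_upwards [isOpen_ne.mem_nhds hy] with z hz
    simp [fieldDeriv_gauge_rpow s η hz, mul_assoc]
  have hpow : gauge y ^ (s - 1) = gauge y ^ (s - 2) * gauge y := by
    rw [← Real.rpow_add_one (gauge_pos.2 hy).ne']
    ring_nf
  have hpow' : s - 1 - 1 = s - 2 := by ring
  rw [fieldDeriv_congr hfirst, fieldDeriv_smul, Pi.smul_apply, fieldDeriv,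
    fderiv_mul ((contDiffAt_gauge_rpow _ hy).differentiableAt one_ne_zero)
      ((contDiff_inner_gaugeGradient η).differentiable one_ne_zero y),
    add_apply, smul_apply, smul_apply, ← fieldDeriv, ← fieldDeriv, fieldDeriv_gauge_rpow _ _ hy,
    hpow, hpow', smul_eq_mul, smul_eq_mul, smul_eq_mul]
  ring

theorem IsHTypeBracket.secondOp_gauge_rpow_nonneg [FiniteDimensional ℝ W] (hb : IsHTypeBracket b)
    (ha : a.IsSymm) {lo hi α : ℝ} (hα : 0 ≤ α) (hlo : ∀ ξ, lo * (ξ ⬝ᵥ ξ) ≤ a.mulVec ξ ⬝ᵥ ξ)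
    (hhi : ∀ ξ, a.mulVec ξ ⬝ᵥ ξ ≤ hi * (ξ ⬝ᵥ ξ))
    (htrace : a.trace + (2 * finrank ℝ W + 2) * hi ≤ (4 * α + 4) * lo) {y : V × W} (hy : y ≠ 0) :
    0 ≤ secondOp (fun i => leftField b (e i)) a (fun z => gauge z ^ (-α)) y := by
  set hess : ℝ := ∑ i, ∑ j,
    a i j * fieldDeriv (leftField b (e i)) (fun z => ⟪gaugeGradient b z, e j⟫_ℝ) y with hhess
  set quad : ℝ := ∑ i, ∑ j,
    a i j * (⟪gaugeGradient b y, e i⟫_ℝ * ⟪gaugeGradient b y, e j⟫_ℝ) with hquad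
  have hop : secondOp (fun i => leftField b (e i)) a (fun z => gauge z ^ (-α)) y =
      α * gauge y ^ (-α - 2) * ((α + 1) * quad - gauge y * hess) := by
    simp only [secondOp, fieldDeriv_fieldDeriv_gauge_rpow _ _ _ hy, hhess, hquad, Finset.mul_sum,
      ← Finset.sum_sub_distrib]
    exact Finset.sum_congr rfl fun i _ => Finset.sum_congr rfl fun j _ => by ring
  have hgauge : 0 ≤ gauge y := gauge_nonneg y
  have hquad_ge : lo * (16 * ‖y.1‖ ^ 2 * gauge y) ≤ quad := by
    rw [← hb.norm_sq_gaugeGradient, ← dotProduct_inner_basis_self e, hquad,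
      ← mulVec_dotProduct_self a (⟪gaugeGradient b y, e ·⟫_ℝ)]
    exact hlo _
  have hhess_le : hess ≤ 4 * ‖y.1‖ ^ 2 * ((4 * α + 4) * lo) :=
    (hb.sum_mul_fieldDeriv_gaugeGradient_le e ha hhi y).trans (by gcongr)
  rw [hop]
  refine mul_nonneg (by positivity) (sub_nonneg.2 ?_)
  calc gauge y * hess ≤ gauge y * (4 * ‖y.1‖ ^ 2 * ((4 * α + 4) * lo)) := by gcongr
    _ = (α + 1) * (lo * (16 * ‖y.1‖ ^ 2 * gauge y)) := by ring
    _ ≤ (α + 1) * quad := by gcongr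

end Barrier

section Potential

open Module

theorem setOf_lt_gauge_rpow_neg_subset {V W : Type*} [NormedAddCommGroup V]
    [NormedAddCommGroup W] {α t : ℝ} (hα : 0 < α) (ht : 0 < t) :
    {y : V × W | t < gauge y ^ (-α)} ⊆ closedGaugeBall V W (t ^ (-(4 * α)⁻¹)) := by
  intro y (hy : t < gauge y ^ (-α))
  have hroot : (t ^ (-(4 * α)⁻¹)) ^ 4 = t ^ (-α)⁻¹ := by
    rw [← Real.rpow_mul_natCast ht.le]
    congr 1
    field_simp
    norm_num
  obtain h0 | hpos := (gauge_nonneg y).eq_or_lt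
  · exact h0.ge.trans (by positivity)
  · change gauge y ≤ _
    rw [hroot]
    exact (Real.le_rpow_inv_iff_of_neg hpos ht (neg_neg_of_pos hα)).2 hy.le

variable {V W : Type*} [NormedAddCommGroup V] [InnerProductSpace ℝ V] [FiniteDimensional ℝ V]
  [MeasurableSpace V] [BorelSpace V] [NormedAddCommGroup W] [InnerProductSpace ℝ W]
  [FiniteDimensional ℝ W] [MeasurableSpace W] [BorelSpace W]

theorem lintegral_gauge_rpow_neg_lt_top {α : ℝ} (hα : 0 < α) (hαQ : 4 * α < homDim V W) :
    ∫⁻ y in closedGaugeBall V W 1, ENNReal.ofReal (gauge y ^ (-α)) < ⊤ := by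
  set β : ENNReal := volume (closedGaugeBall V W 1)
  have hβ : β < ⊤ := (volume_closedGaugeBall_ne_top zero_le_one).lt_top
  set ν : Measure (V × W) := volume.restrict (closedGaugeBall V W 1)
  have hdecay : ∀ t ∈ Set.Ioi (1 : ℝ), ν {y | t < gauge y ^ (-α)} ≤
      ENNReal.ofReal (t ^ (-(4 * α)⁻¹ * homDim V W)) * β := by
    intro t ht
    have ht0 : (0 : ℝ) < t := zero_lt_one.trans ht
    rw [Real.rpow_mul_natCast ht0.le, ← volume_closedGaugeBall (by positivity)]
    exact (Measure.restrict_apply_le _ _).trans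
      (measure_mono (setOf_lt_gauge_rpow_neg_subset hα ht0))
  have hexp : -(4 * α)⁻¹ * homDim V W < -1 := by
    rw [neg_mul, neg_lt_neg_iff, lt_inv_mul_iff₀ (by positivity), mul_one]
    exact hαQ
  calc ∫⁻ y in closedGaugeBall V W 1, ENNReal.ofReal (gauge y ^ (-α))
      = ∫⁻ t in Set.Ioi 0, ν {y | t < gauge y ^ (-α)} :=
        lintegral_eq_lintegral_meas_lt ν
          (ae_of_all _ fun y => Real.rpow_nonneg (gauge_nonneg y) _)
          (continuous_gauge.measurable.pow_const _).aemeasurable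
    _ ≤ (∫⁻ t in Set.Ioc (0 : ℝ) 1, ν {y | t < gauge y ^ (-α)}) +
        ∫⁻ t in Set.Ioi 1, ν {y | t < gauge y ^ (-α)} := by
        rw [← Set.Ioc_union_Ioi_eq_Ioi zero_le_one]
        exact lintegral_union_le _ _ _
    _ ≤ (∫⁻ _ in Set.Ioc (0 : ℝ) 1, β) +
        ∫⁻ t in Set.Ioi 1, ENNReal.ofReal (t ^ (-(4 * α)⁻¹ * homDim V W)) * β := by
        refine add_le_add (lintegral_mono fun t => ?_) (setLIntegral_mono' measurableSet_Ioi hdecay)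
        exact (measure_mono (Set.subset_univ _)).trans (by rw [Measure.restrict_apply_univ])
    _ < ⊤ := by
        rw [lintegral_mul_const' _ _ hβ.ne, setLIntegral_const, Real.volume_Ioc, sub_zero,
          ENNReal.ofReal_one, mul_one]
        exact ENNReal.add_lt_top.2 ⟨hβ,
          ENNReal.mul_lt_top (integrableOn_Ioi_rpow_of_lt hexp one_pos).setLIntegral_lt_top hβ⟩

/-- The potential of `E` with kernel `gauge ^ (-α)`. -/
def potential (b : V →L[ℝ] V →L[ℝ] W) (α : ℝ) (E : Set (V × W)) (y : V × W) : ℝ :=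
  ∫ e in E, gauge (stepTwoMul b (-e) y) ^ (-α)

theorem lintegral_translate_gauge_rpow_neg_le {b : V →L[ℝ] V →L[ℝ] W} (hb : IsHTypeBracket b)
    {α : ℝ} (hα : 0 < α) {E : Set (V × W)} (hE : E ⊆ closedGaugeBall V W 1) (y : V × W) :
    ∫⁻ e in E, ENNReal.ofReal (gauge (stepTwoMul b (-e) y) ^ (-α)) ≤
      (∫⁻ e in closedGaugeBall V W 1, ENNReal.ofReal (gauge e ^ (-α))) +
        volume (closedGaugeBall V W 1) := by
  have hball : MeasurableSet (closedGaugeBall V W 1) := (isClosed_closedGaugeBall 1).measurableSet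
  set φ : V × W → ENNReal :=
    (closedGaugeBall V W 1).indicator fun e => ENNReal.ofReal (gauge e ^ (-α)) with hφ
  have hφm : Measurable φ :=
    (continuous_gauge.measurable.pow_const _).ennreal_ofReal.indicator hball
  have hpointwise (e : V × W) : ENNReal.ofReal (gauge (stepTwoMul b (-e) y) ^ (-α)) ≤
      φ (stepTwoMul b (-y) e) + 1 := by
    rw [hb.gauge_stepTwoMul_neg_comm]
    by_cases hmem : stepTwoMul b (-y) e ∈ closedGaugeBall V W 1
    · rw [hφ, Set.indicator_of_mem hmem]
      exact le_self_add
    · have hone : 1 ≤ gauge (stepTwoMul b (-y) e) :=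
        (not_le.1 (mt mem_closedGaugeBall_one.2 hmem)).le
      exact le_add_left
        (ENNReal.ofReal_le_one.2 (Real.rpow_le_one_of_one_le_of_nonpos hone (by linarith)))
  calc ∫⁻ e in E, ENNReal.ofReal (gauge (stepTwoMul b (-e) y) ^ (-α))
      ≤ ∫⁻ e in E, (φ (stepTwoMul b (-y) e) + 1) := lintegral_mono hpointwise
    _ = (∫⁻ e in E, φ (stepTwoMul b (-y) e)) + volume E := by
        rw [lintegral_add_right _ measurable_const, setLIntegral_one]
    _ ≤ (∫⁻ e, φ (stepTwoMul b (-y) e)) + volume (closedGaugeBall V W 1) :=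
        add_le_add (setLIntegral_le_lintegral _ _) (measure_mono hE)
    _ = _ := by
        rw [(measurePreserving_stepTwoMul_left b (-y)).lintegral_comp hφm, hφ,
          lintegral_indicator hball]

theorem exists_potential_le {α : ℝ} (hα : 0 < α) (hαQ : 4 * α < homDim V W) :
    ∃ M : ℝ, 0 < M ∧ ∀ b : V →L[ℝ] V →L[ℝ] W, IsHTypeBracket b →
      ∀ E ⊆ closedGaugeBall V W 1, ∀ y, potential b α E y ≤ M := by
  set total : ENNReal := (∫⁻ e in closedGaugeBall V W 1, ENNReal.ofReal (gauge e ^ (-α))) +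
    volume (closedGaugeBall V W 1)
  have htop : total ≠ ⊤ := ENNReal.add_ne_top.2
    ⟨(lintegral_gauge_rpow_neg_lt_top hα hαQ).ne, volume_closedGaugeBall_ne_top zero_le_one⟩
  have hpos : total ≠ 0 := ((volume_openGaugeBall_pos one_pos).trans_le
    ((measure_mono (openGaugeBall_subset_closedGaugeBall 1)).trans le_add_self)).ne'
  refine ⟨total.toReal, ENNReal.toReal_pos hpos htop, fun b hb E hE y => ?_⟩
  have hcont : Continuous fun e => stepTwoMul b (-e) y :=
    (continuous_uncurry_stepTwoMul).comp (by fun_prop : Continuous fun e : V × W => (b, -e, y))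
  rw [potential, integral_eq_lintegral_of_nonneg_ae
    (ae_of_all _ fun e => Real.rpow_nonneg (gauge_nonneg _) _)
    (((continuous_gauge.comp hcont).measurable.pow_const _).aestronglyMeasurable)]
  exact ENNReal.toReal_mono htop (lintegral_translate_gauge_rpow_neg_le hb hα hE y)

end Potential

section Comparison

open Module

variable {V W ι : Type*} [NormedAddCommGroup V] [InnerProductSpace ℝ V] [NormedAddCommGroup W]
  [InnerProductSpace ℝ W] [Fintype ι] {b : V →L[ℝ] V →L[ℝ] W} {α : ℝ}

theorem isOpen_setOf_stepTwoMul_neg_ne_zero :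
    IsOpen {t : (V × W) × (V × W) | stepTwoMul b (-t.2) t.1 ≠ 0} :=
  isOpen_ne.preimage ((contDiff_stepTwoMul b (k := 0)).continuous.comp
    (by fun_prop : Continuous fun t : (V × W) × (V × W) => (-t.2, t.1)))

theorem contDiffOn_gauge_rpow_stepTwoMul_neg {k : WithTop ℕ∞} :
    ContDiffOn ℝ k (fun t : (V × W) × (V × W) => gauge (stepTwoMul b (-t.2) t.1) ^ (-α))
      {t | stepTwoMul b (-t.2) t.1 ≠ 0} := fun t ht =>
  ((contDiffAt_gauge_rpow (-α) ht).comp t ((contDiff_stepTwoMul b).comp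
    (contDiff_snd.neg.prodMk contDiff_fst)).contDiffAt).contDiffWithinAt

/-- The matrices `a` for which `gauge ^ (-α)` is a barrier for `∑ a_{ij} Y_i Y_j`, where the `Y_i`
are the left invariant fields of a group of H-type with center of dimension `n`. -/
structure IsBarrierMatrix (n : ℕ) (α : ℝ) (a : Matrix ι ι ℝ) : Prop where
  posSemidef : a.PosSemidef
  trace_pos : 0 < a.trace
  exists_bounds : ∃ lo hi : ℝ, (∀ ξ, lo * (ξ ⬝ᵥ ξ) ≤ a.mulVec ξ ⬝ᵥ ξ) ∧
    (∀ ξ, a.mulVec ξ ⬝ᵥ ξ ≤ hi * (ξ ⬝ᵥ ξ)) ∧ a.trace + (2 * n + 2) * hi ≤ (4 * α + 4) * lo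

variable [FiniteDimensional ℝ V] [FiniteDimensional ℝ W] (e : OrthonormalBasis ι ℝ V)
  {a : Matrix ι ι ℝ} {E : Set (V × W)} {y : V × W}

theorem secondOp_translate_gauge_rpow_neg_nonneg (hb : IsHTypeBracket b) (hα : 0 ≤ α)
    (ha : IsBarrierMatrix (finrank ℝ W) α a) {x : V × W} (hxy : y ≠ x) :
    0 ≤ secondOp (fun i => leftField b (e i)) a
      (fun z => gauge (stepTwoMul b (-x) z) ^ (-α)) y := by
  have hne : stepTwoMul b (-x) y ≠ 0 := mt hb.stepTwoMul_neg_eq_zero.1 hxy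
  obtain ⟨lo, hi, hlo, hhi, htrace⟩ := ha.exists_bounds
  have hcomp := secondOp_comp (a := a) (f := fun z : V × W => gauge z ^ (-α)) (ρ := 1)
    (contDiff_stepTwoMul_left b (-x)) (Y := fun i => leftField b (e i))
    (fun i => (contDiff_leftField b _).contDiffAt) (contDiffAt_gauge_rpow (-α) hne)
    fun i z => by rw [one_smul, fderiv_stepTwoMul_leftField]
  rw [one_pow, one_mul] at hcomp
  exact (hb.secondOp_gauge_rpow_nonneg e
    (Matrix.isHermitian_iff_isSymm.1 ha.posSemidef.isHermitian) hα hlo hhi htrace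
    hne).trans_eq hcomp.symm

variable [MeasurableSpace V] [BorelSpace V] [MeasurableSpace W] [BorelSpace W]

theorem contDiffAt_potential (hb : IsHTypeBracket b) (hE : IsCompact E) (hy : y ∉ E) :
    ContDiffAt ℝ 2 (potential b α E) y :=
  (contDiffOn_two_setIntegral isOpen_setOf_stepTwoMul_neg_ne_zero
    (F := fun z e => gauge (stepTwoMul b (-e) z) ^ (-α)) contDiffOn_gauge_rpow_stepTwoMul_neg
    hE).contDiffAt ((isOpen_setOf_forall_prodMk_mem isOpen_setOf_stepTwoMul_neg_ne_zero hE).mem_nhds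
      fun x hx => mt hb.stepTwoMul_neg_eq_zero.1 fun h : y = x => hy (h ▸ hx))

theorem secondOp_potential_nonneg (hb : IsHTypeBracket b) (hα : 0 ≤ α)
    (ha : IsBarrierMatrix (finrank ℝ W) α a) (hE : IsCompact E) (hy : y ∉ E) :
    0 ≤ secondOp (fun i => leftField b (e i)) a (potential b α E) y := by
  have hne : ∀ x ∈ E, y ≠ x := fun x hx h => hy (h ▸ hx)
  have hop : secondOp (fun i => leftField b (e i)) a (potential b α E) y = _ :=
    secondOp_setIntegral (fun i => contDiff_leftField b (e i)) isOpen_setOf_stepTwoMul_neg_ne_zero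
      (F := fun z e => gauge (stepTwoMul b (-e) z) ^ (-α)) contDiffOn_gauge_rpow_stepTwoMul_neg
      hE fun x hx => mt hb.stepTwoMul_neg_eq_zero.1 (hne x hx)
  rw [hop]
  exact setIntegral_nonneg hE.measurableSet fun x hx =>
    secondOp_translate_gauge_rpow_neg_nonneg e hb hα ha (hne x hx)

omit [MeasurableSpace V] [BorelSpace V] [MeasurableSpace W] [BorelSpace W]

section WeakMaximumPrinciple

variable {K : Set (V × W)} {a : V × W → Matrix ι ι ℝ} {g : V × W → ℝ}

theorem exists_mem_frontier_isMaxOn (hb : IsHTypeBracket b) (hK : IsCompact K) (hK₀ : K.Nonempty)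
    (ha : ∀ y ∈ K, (a y).PosSemidef) (hg : ∀ y ∈ K, ContDiffAt ℝ 2 g y)
    (hpos : ∀ y ∈ K, 0 < secondOp (fun i => leftField b (e i)) (a y) g y) :
    ∃ y ∈ frontier K, IsMaxOn g K y := by
  obtain ⟨y, hy, hmax⟩ :=
    hK.exists_isMaxOn hK₀ fun y hy => (hg y hy).continuousAt.continuousWithinAt
  refine ⟨y, hK.isClosed.frontier_eq ▸ ⟨hy, fun hint => (hpos y hy).not_ge ?_⟩, hmax⟩
  refine secondOp_nonpos_of_isLocalMax (fun ξ t => ?_)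
    (fun i => (contDiff_leftField b (e i)).contDiffAt) (ha y hy) (hg y hy)
    (hmax.isLocalMax (mem_interior_iff_mem_nhds.1 hint))
  rw [sum_smul_leftField, hb.leftField_add_smul]

theorem le_of_forall_frontier_le (hb : IsHTypeBracket b) (hK : IsCompact K)
    (ha : ∀ y ∈ K, (a y).PosSemidef) (htrace : ∀ y ∈ K, 0 < (a y).trace)
    (hg : ∀ y ∈ K, ContDiffAt ℝ 2 g y)
    (hsub : ∀ y ∈ K, 0 ≤ secondOp (fun i => leftField b (e i)) (a y) g y) {B : ℝ}
    (hB : ∀ y ∈ frontier K, g y ≤ B) {x : V × W} (hx : x ∈ K) : g x ≤ B := by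
  obtain ⟨R, hR, hKR⟩ := hK.isBounded.exists_pos_norm_le
  refine le_of_forall_pos_le_add fun τ hτ => ?_
  set q : V × W → ℝ := (τ / R ^ 2) • fun z => ‖z.1‖ ^ 2 with hq
  have hqC (y : V × W) : ContDiffAt ℝ 2 q y :=
    ((contDiff_fst.norm_sq ℝ).const_smul (τ / R ^ 2)).contDiffAt
  have hstrict : ∀ y ∈ K, 0 < secondOp (fun i => leftField b (e i)) (a y) (g + q) y := by
    intro y hy
    rw [secondOp_add (fun i => (contDiff_leftField b (e i)).contDiffAt) (hg y hy) (hqC y), hq,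
      secondOp_smul, secondOp_norm_fst_sq]
    have htr := htrace y hy
    exact add_pos_of_nonneg_of_pos (hsub y hy) (by positivity)
  obtain ⟨y, hy, hmax⟩ := exists_mem_frontier_isMaxOn e hb hK ⟨x, hx⟩ ha
    (fun y hy => (hg y hy).add (hqC y)) hstrict
  have hyR : ‖y.1‖ ^ 2 ≤ R ^ 2 :=
    pow_le_pow_left₀ (norm_nonneg _)
      ((norm_fst_le y).trans (hKR y (hK.isClosed.frontier_subset hy))) 2
  calc g x ≤ g x + τ / R ^ 2 * ‖x.1‖ ^ 2 := le_add_of_nonneg_right (by positivity)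
    _ ≤ g y + τ / R ^ 2 * ‖y.1‖ ^ 2 := hmax hx
    _ ≤ B + τ / R ^ 2 * R ^ 2 := by gcongr; exact hB y hy
    _ = B + τ := by rw [div_mul_cancel₀ _ (by positivity)]

end WeakMaximumPrinciple

end Comparison

section ModelCriticalDensity

open Module

variable {V W ι : Type*} [NormedAddCommGroup V] [InnerProductSpace ℝ V]
  [NormedAddCommGroup W] [InnerProductSpace ℝ W] [Fintype ι]

/-- A nonnegative supersolution `v` on `U` of `∑ a_{ij} Y_i Y_j`, where the `Y_i` are the left
invariant fields of an orthonormal basis, for coefficients making `gauge ^ (-α)` a barrier. -/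
structure IsBarrierSupersolution (b : V →L[ℝ] V →L[ℝ] W) (e : OrthonormalBasis ι ℝ V) (α : ℝ)
    (U : Set (V × W)) (a : V × W → Matrix ι ι ℝ) (v : V × W → ℝ) : Prop where
  isBarrierMatrix : ∀ y ∈ U, IsBarrierMatrix (finrank ℝ W) α (a y)
  contDiffOn : ContDiffOn ℝ 2 v U
  nonneg : ∀ y ∈ U, 0 ≤ v y
  secondOp_nonpos : ∀ y ∈ U, secondOp (fun i => leftField b (e i)) (a y) v y ≤ 0

variable {b : V →L[ℝ] V →L[ℝ] W} {e : OrthonormalBasis ι ℝ V} {α : ℝ} {U E : Set (V × W)}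
  {a : V × W → Matrix ι ι ℝ} {v : V × W → ℝ}

theorem IsBarrierSupersolution.comp (h : IsBarrierSupersolution b e α U a v) (hU : IsOpen U)
    (x : V × W) (r : ℝ) :
    IsBarrierSupersolution b e α ((fun y => stepTwoMul b x (dilate r y)) ⁻¹' U)
      (fun y => a (stepTwoMul b x (dilate r y))) (fun y => v (stepTwoMul b x (dilate r y))) where
  isBarrierMatrix y hy := h.isBarrierMatrix _ hy
  contDiffOn := h.contDiffOn.comp
    ((contDiff_stepTwoMul_left b x).comp (contDiff_dilate r)).contDiffOn fun _ hy => hy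
  nonneg y hy := h.nonneg _ hy
  secondOp_nonpos y hy := by
    have hcomp := secondOp_comp (a := a (stepTwoMul b x (dilate r y)))
      ((contDiff_stepTwoMul_left b x).comp (contDiff_dilate r))
      (fun i => (contDiff_leftField b (e i)).contDiffAt)
      (h.contDiffOn.contDiffAt (hU.mem_nhds hy))
      fun i z => fderiv_stepTwoMul_dilate_leftField b x r (e i) z
    exact hcomp.trans_le (mul_nonpos_of_nonneg_of_nonpos (sq_nonneg r) (h.secondOp_nonpos _ hy))

variable [FiniteDimensional ℝ V] [FiniteDimensional ℝ W]

theorem exists_stepTwoMul_dilate_mem_openGaugeBall :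
    ∃ θ : ℝ, 0 < θ ∧ θ ≤ 1 ∧ ∀ b : V →L[ℝ] V →L[ℝ] W, IsHTypeBracket b →
      ∀ x ∈ openGaugeBall V W (1 / 2), ∀ y ∈ closedGaugeBall V W 1,
        stepTwoMul b x (dilate θ y) ∈ openGaugeBall V W 1 := by
  obtain ⟨θ, hθ, hθ1, hlt⟩ := exists_forall_closedGaugeBall_lt
    (continuous_gauge.comp continuous_uncurry_stepTwoMul)
    (isCompact_closedGaugeBall (V := V) (W := W) (r := 1 / 2) (by norm_num)) (a := 1 ^ 4)
    fun b x hx => by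
      rw [Function.comp_apply, stepTwoMul_zero]
      exact lt_of_le_of_lt hx (by norm_num)
  refine ⟨θ, hθ, hθ1, fun b hb x hx y hy =>
    hlt b hb x (openGaugeBall_subset_closedGaugeBall _ hx) _ ?_⟩
  rwa [← preimage_dilate_closedGaugeBall hθ, mul_one] at hy

theorem isCompact_closedGaugeBall_inter_preimage {r : ℝ} (hr : 0 ≤ r)
    (hrU : closedGaugeBall V W r ⊆ U) (hv : ContinuousOn v U) {s : Set ℝ} (hs : IsClosed s) :
    IsCompact (closedGaugeBall V W r ∩ v ⁻¹' s) :=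
  (isCompact_closedGaugeBall hr).of_isClosed_subset
    ((hv.mono hrU).preimage_isClosed_of_isClosed (isClosed_closedGaugeBall r) hs)
    Set.inter_subset_left

theorem gauge_eq_one_or_eq_of_mem_frontier (hU : IsOpen U) (hball : closedGaugeBall V W 1 ⊆ U)
    (hv : ContinuousOn v U) {t : ℝ} {y : V × W}
    (hy : y ∈ frontier (closedGaugeBall V W 1 ∩ v ⁻¹' Set.Iic t)) : gauge y = 1 ∨ v y = t := by
  set K : Set (V × W) := closedGaugeBall V W 1 ∩ v ⁻¹' Set.Iic t
  have hKc : IsClosed K :=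
    (isCompact_closedGaugeBall_inter_preimage zero_le_one hball hv isClosed_Iic).isClosed
  rw [hKc.frontier_eq] at hy
  obtain ⟨⟨hy1, hyt⟩, hint⟩ := hy
  by_contra! hne
  have hy1' : gauge y < 1 := lt_of_le_of_ne (mem_closedGaugeBall_one.1 hy1) hne.1
  have hyt' : v y < t := lt_of_le_of_ne hyt hne.2
  refine hint (mem_interior_iff_mem_nhds.2 ?_)
  filter_upwards [continuous_gauge.continuousAt.eventually_lt_const hy1',
    (hv.continuousAt (hU.mem_nhds (hball hy1))).eventually_lt_const hyt'] with z hz hzt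
  exact ⟨mem_closedGaugeBall_one.2 hz.le, hzt.le⟩

variable [MeasurableSpace V] [BorelSpace V] [MeasurableSpace W] [BorelSpace W]

namespace IsBarrierSupersolution

theorem potential_sub_div_le (h : IsBarrierSupersolution b e α U a v) (hb : IsHTypeBracket b)
    (hα : 0 ≤ α) (hU : IsOpen U) (hball : closedGaugeBall V W 1 ⊆ U) (hE : IsCompact E)
    (hvE : ∀ y ∈ E, 1 ≤ v y) {M c : ℝ} (hM : 0 < M) (hc : 0 ≤ c)
    (hEM : ∀ y, potential b α E y ≤ M)
    (hEc : ∀ y, gauge y = 1 → potential b α E y ≤ c) (hv0 : v 0 ≤ 1 / 2) :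
    (potential b α E 0 - c) / (2 * M) ≤ v 0 := by
  set K : Set (V × W) := closedGaugeBall V W 1 ∩ v ⁻¹' Set.Iic (1 / 2)
  have hK : IsCompact K := isCompact_closedGaugeBall_inter_preimage zero_le_one hball
    h.contDiffOn.continuousOn isClosed_Iic
  have hKU : K ⊆ U := Set.inter_subset_left.trans hball
  have hKE : ∀ y ∈ K, y ∉ E := fun y hy hyE => by
    linarith [hvE y hyE, show v y ≤ 1 / 2 from hy.2]
  have hvC : ∀ y ∈ K, ContDiffAt ℝ 2 v y := fun y hy =>
    h.contDiffOn.contDiffAt (hU.mem_nhds (hKU hy))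
  have hpC : ∀ y ∈ K, ContDiffAt ℝ 2 ((2 * M)⁻¹ • potential b α E) y := fun y hy =>
    contDiffAt_const.smul (contDiffAt_potential hb hE (hKE y hy))
  have hsub : ∀ y ∈ K, 0 ≤ secondOp (fun i => leftField b (e i)) (a y)
      ((2 * M)⁻¹ • potential b α E - v) y := by
    intro y hy
    rw [secondOp_sub (fun i => (contDiff_leftField b (e i)).contDiffAt) (hpC y hy) (hvC y hy),
      secondOp_smul]
    have hp := secondOp_potential_nonneg e hb hα (h.isBarrierMatrix y (hKU hy)) hE (hKE y hy)
    exact sub_nonneg.2 ((h.secondOp_nonpos y (hKU hy)).trans (by positivity))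
  have hfrontier : ∀ y ∈ frontier K, ((2 * M)⁻¹ • potential b α E - v) y ≤ c / (2 * M) := by
    intro y hy
    simp only [Pi.sub_apply, Pi.smul_apply, smul_eq_mul, inv_mul_eq_div]
    rcases gauge_eq_one_or_eq_of_mem_frontier hU hball h.contDiffOn.continuousOn hy with hy1 | hy2
    · have hvy : 0 ≤ v y := h.nonneg y (hKU (hK.isClosed.frontier_subset hy))
      exact (sub_le_self _ hvy).trans (by gcongr; exact hEc y hy1)
    · have hhalf : potential b α E y / (2 * M) ≤ 1 / 2 := by
        rw [div_le_iff₀ (by positivity)]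
        linarith [hEM y]
      exact (sub_nonpos.2 (hhalf.trans hy2.ge)).trans (by positivity)
  have hmain := le_of_forall_frontier_le e hb hK
    (fun y hy => (h.isBarrierMatrix y (hKU hy)).posSemidef)
    (fun y hy => (h.isBarrierMatrix y (hKU hy)).trace_pos) (fun y hy => (hpC y hy).sub (hvC y hy))
    hsub hfrontier (x := 0) ⟨by simp [mem_closedGaugeBall_one], hv0⟩
  simp only [Pi.smul_apply, smul_eq_mul, inv_mul_eq_div] at hmain
  rwa [sub_div, sub_le_comm]

end IsBarrierSupersolution

theorem exists_forall_potential_le_of_gauge_eq_one {α : ℝ} (hα : 0 ≤ α) :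
    ∃ r : ℝ, 0 < r ∧ r ≤ 1 ∧ ∀ b : V →L[ℝ] V →L[ℝ] W, IsHTypeBracket b →
      ∀ E ⊆ closedGaugeBall V W r, ∀ y, gauge y = 1 →
        potential b α E y ≤ 2 ^ α * volume.real E := by
  have hsphere : IsCompact {y : V × W | gauge y = 1} :=
    (isCompact_closedGaugeBall zero_le_one).of_isClosed_subset
      (isClosed_eq continuous_gauge continuous_const)
      fun y hy => mem_closedGaugeBall_one.2 (le_of_eq hy)
  have hcont : Continuous fun t : (V →L[ℝ] V →L[ℝ] W) × (V × W) × (V × W) =>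
      -gauge (stepTwoMul t.1 (-t.2.2) t.2.1) :=
    (continuous_gauge.comp (continuous_uncurry_stepTwoMul.comp (by fun_prop :
      Continuous fun t : (V →L[ℝ] V →L[ℝ] W) × (V × W) × (V × W) =>
        (t.1, -t.2.2, t.2.1)))).neg
  obtain ⟨r, hr, hr1, hlt⟩ := exists_forall_closedGaugeBall_lt hcont hsphere (a := -(1 / 2))
    fun b y (hy : gauge y = 1) => by norm_num [hy]
  refine ⟨r, hr, hr1, fun b hb E hE y hy => ?_⟩
  have hkernel : ∀ e ∈ E, ‖gauge (stepTwoMul b (-e) y) ^ (-α)‖ ≤ 2 ^ α := by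
    intro e he
    have hhalf : (1 / 2 : ℝ) ≤ gauge (stepTwoMul b (-e) y) :=
      (neg_lt_neg_iff.1 (hlt b hb y hy e (hE he))).le
    rw [Real.norm_of_nonneg (Real.rpow_nonneg (gauge_nonneg _) _)]
    refine (Real.rpow_le_rpow_of_nonpos (by norm_num) hhalf (neg_nonpos.2 hα)).trans_eq ?_
    rw [one_div, Real.inv_rpow zero_le_two, Real.rpow_neg zero_le_two, inv_inv]
  exact (le_abs_self _).trans (norm_setIntegral_le_of_norm_le_const
    ((measure_mono hE).trans_lt (volume_closedGaugeBall_ne_top hr.le).lt_top) hkernel)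

theorem le_potential_zero (hα : 0 ≤ α) (hE : IsCompact E) (hE₀ : 0 ∉ E) {r : ℝ}
    (hEr : E ⊆ closedGaugeBall V W r) : (r ^ 4) ^ (-α) * volume.real E ≤ potential b α E 0 := by
  have hne : ∀ e ∈ E, e ≠ 0 := fun e he h => hE₀ (h ▸ he)
  simp only [potential, stepTwoMul_zero, gauge_neg]
  refine setIntegral_ge_of_const_le_real hE.measurableSet hE.measure_lt_top.ne
    (fun e he => Real.rpow_le_rpow_of_nonpos (gauge_pos.2 (hne e he)) (hEr he) (neg_nonpos.2 hα))
    (ContinuousOn.integrableOn_compact hE fun e he =>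
      (contDiffAt_gauge_rpow (k := 0) (-α) (hne e he)).continuousAt.continuousWithinAt)

theorem exists_lt_rpow_pow_four_neg {α : ℝ} (hα : 0 < α) (L : ℝ) {r : ℝ} (hr : 0 < r) :
    ∃ η : ℝ, 0 < η ∧ η < r ∧ L ≤ (η ^ 4) ^ (-α) := by
  have hpow : Tendsto (fun η : ℝ => η ^ 4) (𝓝[>] 0) (𝓝[>] 0) :=
    tendsto_nhdsWithin_iff.2
      ⟨((continuous_pow 4).tendsto' 0 0 (by norm_num)).mono_left nhdsWithin_le_nhds,
        eventually_mem_nhdsWithin.mono fun η (hη : 0 < η) => Set.mem_Ioi.2 (pow_pos hη 4)⟩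
  obtain ⟨η, hL, hη0, hηr⟩ := ((((tendsto_rpow_neg_nhdsGT_zero (neg_neg_of_pos hα)).comp
    hpow).eventually_ge_atTop L).and (Ioo_mem_nhdsGT hr)).exists
  exact ⟨η, hη0, hηr, hL⟩

theorem half_measureReal_closedGaugeBall_le {r : ℝ}
    (hdensity : volume.real (closedGaugeBall V W r ∩ v ⁻¹' Set.Iio 1) ≤
      volume.real (closedGaugeBall V W r) / 2) :
    volume.real (closedGaugeBall V W r) / 2 ≤
      volume.real (closedGaugeBall V W r ∩ v ⁻¹' Set.Ici 1) := by
  have hcover : (closedGaugeBall V W r ∩ v ⁻¹' Set.Iio 1) ∪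
      (closedGaugeBall V W r ∩ v ⁻¹' Set.Ici 1) = closedGaugeBall V W r := by
    rw [← Set.inter_union_distrib_left, ← Set.preimage_union, Set.Iio_union_Ici,
      Set.preimage_univ, Set.inter_univ]
  have hunion := measureReal_union_le (μ := volume) (closedGaugeBall V W r ∩ v ⁻¹' Set.Iio 1)
    (closedGaugeBall V W r ∩ v ⁻¹' Set.Ici 1)
  rw [hcover] at hunion
  linarith

theorem exists_le_apply_zero (e : OrthonormalBasis ι ℝ V) {α : ℝ} (hα : 0 < α)
    (hαQ : 4 * α < homDim V W) :
    ∃ η κ : ℝ, 0 < η ∧ η ≤ 1 ∧ 0 < κ ∧ ∀ b : V →L[ℝ] V →L[ℝ] W, IsHTypeBracket b →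
      ∀ U, IsOpen U → closedGaugeBall V W 1 ⊆ U → ∀ a v, IsBarrierSupersolution b e α U a v →
        volume.real (closedGaugeBall V W η ∩ v ⁻¹' Set.Iio 1) ≤
          volume.real (closedGaugeBall V W η) / 2 → κ ≤ v 0 := by
  obtain ⟨r, hr, hr1, hsphere⟩ :=
    exists_forall_potential_le_of_gauge_eq_one (V := V) (W := W) hα.le
  obtain ⟨η, hη, hηr, hηL⟩ := exists_lt_rpow_pow_four_neg hα (2 ^ α + 1) hr
  obtain ⟨M, hM, hpotential⟩ := exists_potential_le hα hαQ
  have hη1 : η ≤ 1 := hηr.le.trans hr1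
  have hηball : closedGaugeBall V W η ⊆ closedGaugeBall V W 1 :=
    closedGaugeBall_subset_closedGaugeBall hη.le hη1
  set β : ℝ := volume.real (closedGaugeBall V W η)
  have hβ : 0 < β := ENNReal.toReal_pos ((volume_openGaugeBall_pos hη).trans_le
    (measure_mono (openGaugeBall_subset_closedGaugeBall η))).ne'
    (volume_closedGaugeBall_ne_top hη.le)
  refine ⟨η, min (1 / 2) (β / 2 / (2 * M)), hη, hη1, by positivity, ?_⟩
  intro b hb U hU hball a v h hdensity
  rcases le_or_gt (v 0) (1 / 2) with hv0 | hv0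
  swap
  · exact (min_le_left _ _).trans hv0.le
  set E : Set (V × W) := closedGaugeBall V W η ∩ v ⁻¹' Set.Ici 1
  have hE : IsCompact E := isCompact_closedGaugeBall_inter_preimage hη.le (hηball.trans hball)
    h.contDiffOn.continuousOn isClosed_Ici
  have hE₀ : (0 : V × W) ∉ E := fun h0 => by linarith [show 1 ≤ v 0 from h0.2]
  have hEη : E ⊆ closedGaugeBall V W η := Set.inter_subset_left
  have hEβ : β / 2 ≤ volume.real E := half_measureReal_closedGaugeBall_le hdensity
  calc min (1 / 2) (β / 2 / (2 * M)) ≤ volume.real E / (2 * M) :=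
        (min_le_right _ _).trans (by gcongr)
    _ ≤ (potential b α E 0 - 2 ^ α * volume.real E) / (2 * M) := by
        gcongr
        have := mul_le_mul_of_nonneg_right hηL (measureReal_nonneg (μ := volume) (s := E))
        linarith [le_potential_zero (b := b) hα.le hE hE₀ hEη]
    _ ≤ v 0 := h.potential_sub_div_le hb hα.le hU hball hE (fun y hy => hy.2) hM (by positivity)
        (hpotential b hb E (hEη.trans hηball))
        (hsphere b hb E (hEη.trans (closedGaugeBall_subset_closedGaugeBall hη.le hηr.le))) hv0

theorem measureReal_inter_preimage_Iio_le {X : Type*} [MeasurableSpace X] {μ : Measure X}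
    {s : Set X} {u : X → ℝ} {c ε : ℝ} (hu : MeasurableSet (s ∩ u ⁻¹' Set.Iio c)) (hs : μ s ≠ ⊤)
    (hε : 0 ≤ ε) (h : ENNReal.ofReal ε * μ s ≤ μ {y ∈ s | c ≤ u y}) :
    μ.real (s ∩ u ⁻¹' Set.Iio c) ≤ (1 - ε) * μ.real s := by
  have hsuper : {y ∈ s | c ≤ u y} = s \ (s ∩ u ⁻¹' Set.Iio c) := by
    ext y
    simp only [Set.sdiff_self_inter, Set.mem_sdiff, Set.mem_preimage, Set.mem_Iio, not_lt,
      Set.mem_ofPred_eq]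
  rw [hsuper] at h
  have hreal := ENNReal.toReal_mono (measure_ne_top_of_subset Set.sdiff_subset hs) h
  rw [ENNReal.toReal_mul, ENNReal.toReal_ofReal hε] at hreal
  have hsdiff := measureReal_sdiff Set.inter_subset_left hu (μ := μ)
  simp only [measureReal_def] at hsdiff ⊢
  linarith

theorem measureReal_le_of_subset_preimage_stepTwoMul_dilate (b : V →L[ℝ] V →L[ℝ] W) (x : V × W)
    {r : ℝ} (hr : 0 < r) {s t : Set (V × W)} (ht : MeasurableSet t) (ht' : volume t ≠ ⊤)
    (hst : s ⊆ (fun y => stepTwoMul b x (dilate r y)) ⁻¹' t) :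
    volume.real s ≤ (r ^ homDim V W)⁻¹ * volume.real t := by
  have hx := measurePreserving_stepTwoMul_left b x
  have hvol : volume ((fun y => stepTwoMul b x (dilate r y)) ⁻¹' t) =
      ENNReal.ofReal ((r ^ homDim V W)⁻¹) * volume t := by
    rw [← Function.comp_def (stepTwoMul b x), Set.preimage_comp,
      volume_preimage_dilate hr (hx.measurable ht), hx.measure_preimage ht.nullMeasurableSet]
  have hle := ENNReal.toReal_mono (ENNReal.mul_ne_top ENNReal.ofReal_ne_top ht')
    ((measure_mono hst).trans_eq hvol)
  rwa [ENNReal.toReal_mul, ENNReal.toReal_ofReal (by positivity)] at hle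

/-- The critical density property of the unit ball, with constants `ε` and `κ`, for the left
invariant fields of the model group with bracket `b`. -/
def UnitBallCriticalDensity (b : V →L[ℝ] V →L[ℝ] W) (e : OrthonormalBasis ι ℝ V)
    (α ε κ : ℝ) : Prop :=
  ∀ U, IsOpen U → openGaugeBall V W 1 ⊆ U → ∀ a u, IsBarrierSupersolution b e α U a u →
    ENNReal.ofReal ε * volume (openGaugeBall V W 1) ≤
      volume {y ∈ openGaugeBall V W 1 | 1 ≤ u y} →
    ∀ x ∈ openGaugeBall V W (1 / 2), κ ≤ u x

theorem exists_unitBallCriticalDensity (e : OrthonormalBasis ι ℝ V) {α : ℝ} (hα : 0 < α)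
    (hαQ : 4 * α < homDim V W) :
    ∃ ε κ : ℝ, 0 < ε ∧ ε < 1 ∧ 0 < κ ∧ ∀ b : V →L[ℝ] V →L[ℝ] W, IsHTypeBracket b →
      UnitBallCriticalDensity b e α ε κ := by
  obtain ⟨θ, hθ, hθ1, hinside⟩ := exists_stepTwoMul_dilate_mem_openGaugeBall (V := V) (W := W)
  obtain ⟨η, κ, hη, hη1, hκ, hcenter⟩ := exists_le_apply_zero e hα hαQ
  set Q : ℕ := homDim V W
  have hσ : (η * θ) ^ Q ≤ 1 := pow_le_one₀ (by positivity) (mul_le_one₀ hη1 hθ.le hθ1)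
  have hσ0 : 0 < (η * θ) ^ Q := by positivity
  refine ⟨1 - (η * θ) ^ Q / 2, κ, by linarith, by linarith, hκ, ?_⟩
  intro b hb U hU hball a u h hdensity x hx
  set T : V × W → V × W := fun y => stepTwoMul b x (dilate θ y)
  have hT : Continuous T :=
    ((contDiff_stepTwoMul_left b x).comp (contDiff_dilate θ) (n := 0)).continuous
  set F : Set (V × W) := openGaugeBall V W 1 ∩ u ⁻¹' Set.Iio 1
  have hF : MeasurableSet F := ((h.contDiffOn.continuousOn.mono hball).isOpen_inter_preimage
    (isOpen_openGaugeBall 1) isOpen_Iio).measurableSet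
  have hball1 := openGaugeBall_subset_closedGaugeBall (V := V) (W := W) 1
  have htop : volume (openGaugeBall V W 1) ≠ ⊤ :=
    measure_ne_top_of_subset hball1 (volume_closedGaugeBall_ne_top zero_le_one)
  have hFle : volume.real F ≤ (η * θ) ^ Q / 2 * volume.real (closedGaugeBall V W 1) := by
    refine (measureReal_inter_preimage_Iio_le hF htop (by linarith) hdensity).trans ?_
    rw [sub_sub_cancel]
    gcongr
    exact volume_closedGaugeBall_ne_top zero_le_one
  have hTF : closedGaugeBall V W η ∩ (u ∘ T) ⁻¹' Set.Iio 1 ⊆ T ⁻¹' F := fun y hy =>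
    ⟨hinside b hb x hx y (closedGaugeBall_subset_closedGaugeBall hη.le hη1 hy.1), hy.2⟩
  have hTx : T 0 = x := by simp [T]
  rw [← hTx]
  refine hcenter b hb _ (hU.preimage hT) (fun y hy => hball (hinside b hb x hx y hy)) _ _
    (h.comp hU x θ) ?_
  calc volume.real (closedGaugeBall V W η ∩ (u ∘ T) ⁻¹' Set.Iio 1)
      ≤ (θ ^ Q)⁻¹ * volume.real F := measureReal_le_of_subset_preimage_stepTwoMul_dilate b x hθ hF
        (measure_ne_top_of_subset Set.inter_subset_left htop) hTF
    _ ≤ (θ ^ Q)⁻¹ * ((η * θ) ^ Q / 2 * volume.real (closedGaugeBall V W 1)) := by gcongr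
    _ = volume.real (closedGaugeBall V W η) / 2 := by
        rw [measureReal_closedGaugeBall hη, mul_pow]
        change _ = η ^ Q * _ / 2
        field_simp

end ModelCriticalDensity

section LandisCondition

variable {m n : ℕ} {a : Matrix (Fin m) (Fin m) ℝ}

theorem rayleighQuotient_mem_sphereValues (a : Matrix (Fin m) (Fin m) ℝ) {ξ : Fin m → ℝ}
    (hξ : ξ ≠ 0) : (a.mulVec ξ ⬝ᵥ ξ) / (ξ ⬝ᵥ ξ) ∈ sphereValues a := by
  have hpos : 0 < ξ ⬝ᵥ ξ := by simpa using Matrix.dotProduct_star_self_pos_iff.2 hξ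
  refine ⟨(√(ξ ⬝ᵥ ξ))⁻¹ • ξ, ?_, ?_⟩
  · simp only [Set.mem_ofPred_eq, smul_dotProduct, dotProduct_smul, smul_eq_mul, ← mul_assoc]
    rw [← mul_inv, Real.mul_self_sqrt hpos.le, inv_mul_cancel₀ hpos.ne']
  · simp only [Matrix.mulVec_smul, smul_dotProduct, dotProduct_smul, smul_eq_mul, ← mul_assoc]
    rw [← mul_inv, Real.mul_self_sqrt hpos.le, inv_mul_eq_div]

theorem isCompact_sphereValues (a : Matrix (Fin m) (Fin m) ℝ) : IsCompact (sphereValues a) := by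
  refine IsCompact.image (Metric.isCompact_of_isClosed_isBounded ?_ ?_) (by fun_prop)
  · exact isClosed_eq (by fun_prop) continuous_const
  · refine (Metric.isBounded_closedBall (x := 0) (r := 1)).subset fun ξ hξ => ?_
    rw [mem_closedBall_zero_iff, pi_norm_le_iff_of_nonneg zero_le_one]
    intro i
    rw [Real.norm_eq_abs, ← sq_le_one_iff_abs_le_one, sq]
    exact (Finset.single_le_sum (f := fun j => ξ j * ξ j) (fun j _ => mul_self_nonneg _)
      (Finset.mem_univ i)).trans_eq hξ

theorem sInf_sphereValues_mul_le (a : Matrix (Fin m) (Fin m) ℝ) (ξ : Fin m → ℝ) :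
    sInf (sphereValues a) * (ξ ⬝ᵥ ξ) ≤ a.mulVec ξ ⬝ᵥ ξ := by
  obtain rfl | hξ := eq_or_ne ξ 0
  · simp
  · have hpos : 0 < ξ ⬝ᵥ ξ := by simpa using Matrix.dotProduct_star_self_pos_iff.2 hξ
    exact (le_div_iff₀ hpos).1
      (csInf_le (isCompact_sphereValues a).bddBelow (rayleighQuotient_mem_sphereValues a hξ))

theorem le_sSup_sphereValues_mul (a : Matrix (Fin m) (Fin m) ℝ) (ξ : Fin m → ℝ) :
    a.mulVec ξ ⬝ᵥ ξ ≤ sSup (sphereValues a) * (ξ ⬝ᵥ ξ) := by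
  obtain rfl | hξ := eq_or_ne ξ 0
  · simp
  · have hpos : 0 < ξ ⬝ᵥ ξ := by simpa using Matrix.dotProduct_star_self_pos_iff.2 hξ
    exact (div_le_iff₀ hpos).1
      (le_csSup (isCompact_sphereValues a).bddAbove (rayleighQuotient_mem_sphereValues a hξ))

theorem IsElliptic.posDef {lam Lam : ℝ} (ha : IsElliptic lam Lam a) (hlam : 0 < lam) :
    a.PosDef := by
  refine Matrix.PosDef.of_dotProduct_mulVec_pos ?_ fun ξ hξ => ?_
  · rw [Matrix.IsHermitian, Matrix.conjTranspose_eq_transpose_of_trivial]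
    exact ha.1
  · rw [star_trivial, dotProduct_comm]
    have hpos : 0 < ξ ⬝ᵥ ξ := by simpa using Matrix.dotProduct_star_self_pos_iff.2 hξ
    exact (mul_pos hlam hpos).trans_le (ha.2 ξ).1

theorem IsLandis.of_le {δ δ' : ℝ} (ha : a.PosSemidef) (hl : IsLandis n δ a) (hδ : δ' ≤ δ) :
    IsLandis n δ' a := by
  have hnonneg : 0 ≤ sInf (sphereValues a) := by
    refine Real.sInf_nonneg ?_
    rintro _ ⟨ξ, -, rfl⟩
    change 0 ≤ a.mulVec ξ ⬝ᵥ ξ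
    rw [dotProduct_comm]
    exact ha.dotProduct_mulVec_nonneg ξ
  exact le_trans hl (mul_le_mul_of_nonneg_right (by linarith) hnonneg)

theorem IsLandis.isBarrierMatrix {δ : ℝ} (hm : 0 < m) (ha : a.PosDef) (hl : IsLandis n δ a) :
    IsBarrierMatrix n ((m + 2 * n - δ) / 4) a where
  posSemidef := ha.posSemidef
  trace_pos := by
    have : Nonempty (Fin m) := ⟨⟨0, hm⟩⟩
    exact ha.trace_pos
  exists_bounds := by
    refine ⟨sInf (sphereValues a), sSup (sphereValues a), sInf_sphereValues_mul_le a,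
      le_sSup_sphereValues_mul a, ?_⟩
    simp only [IsLandis] at hl
    linear_combination hl

end LandisCondition

section HomogeneousMaps

variable {M N : Type*} [NormedAddCommGroup M] [NormedSpace ℝ M] [NormedAddCommGroup N]
  [NormedSpace ℝ N]

/-- The dilation which multiplies the range of the projection `h` by `r` and its kernel
by `r ^ 2`. -/
def gradedDilation (h : N →L[ℝ] N) (r : ℝ) (x : N) : N := r • h x + r ^ 2 • (x - h x)

theorem eq_zero_of_hasDerivAt_of_forall_pos {f : ℝ → M} {f' : M} (hf : HasDerivAt f f' 0)
    (h : ∀ r, 0 < r → f r = 0) : f 0 = 0 ∧ f' = 0 := by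
  have hzero : f 0 = 0 := by
    refine tendsto_nhds_unique (hf.continuousAt.continuousWithinAt (s := Set.Ioi 0)) ?_
    refine tendsto_const_nhds.congr' ?_
    filter_upwards [self_mem_nhdsWithin] with r hr using (h r hr).symm
  exact ⟨hzero, (uniqueDiffWithinAt_Ioi 0).eq_deriv _ hf.hasDerivWithinAt
    ((hasDerivWithinAt_const 0 (Set.Ioi 0) 0).congr h hzero)⟩

theorem hasDerivAt_smul_add_sq_smul (a b : M) (r : ℝ) :
    HasDerivAt (fun r : ℝ => r • a + r ^ 2 • b) (a + (2 * r) • b) r := by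
  simpa [Pi.add_def] using ((hasDerivAt_id r).smul_const a).add
    ((hasDerivAt_pow 2 r).smul_const b)

theorem hasDerivAt_add_two_mul_smul (a b : M) (r : ℝ) :
    HasDerivAt (fun r : ℝ => a + (2 * r) • b) ((2 : ℝ) • b) r := by
  simpa using (((hasDerivAt_id r).const_mul 2).smul_const b).const_add a

theorem derivs_eq_of_quadratic_of_forall_pos {g g₁ : ℝ → M} {g₂ a b : M}
    (hg : ∀ r, HasDerivAt g (g₁ r) r) (hg₁ : HasDerivAt g₁ g₂ 0)
    (h : ∀ r, 0 < r → g r = r • a + r ^ 2 • b) : g₁ 0 = a ∧ g₂ = (2 : ℝ) • b := by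
  have hderiv (r : ℝ) (hr : 0 < r) : g₁ r - (a + (2 * r) • b) = 0 := by
    refine sub_eq_zero.2 ((hg r).unique
      ((hasDerivAt_smul_add_sq_smul a b r).congr_of_eventuallyEq ?_))
    filter_upwards [lt_mem_nhds hr] with s hs using h s hs
  have := eq_zero_of_hasDerivAt_of_forall_pos (hg₁.sub (hasDerivAt_add_two_mul_smul a b 0)) hderiv
  simpa [sub_eq_zero] using this

theorem eq_quadratic_of_homogeneous {P : N → M} (hP : ContDiff ℝ 2 P) {hN : N →L[ℝ] N}
    {hM : M →L[ℝ] M}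
    (hhom : ∀ r, 0 < r → ∀ z, P (gradedDilation hN r z) = gradedDilation hM r (P z)) (z : N) :
    hM (P z) = fderiv ℝ P 0 (hN z) ∧
      P z = fderiv ℝ P 0 z + (1 / 2 : ℝ) • fderiv ℝ (fderiv ℝ P) 0 (hN z) (hN z) := by
  set a := hN z
  set b := z - hN z
  have hcurve (r : ℝ) : HasDerivAt (fun r => gradedDilation hN r z) (a + (2 * r) • b) r :=
    hasDerivAt_smul_add_sq_smul a b r
  have hzero : gradedDilation hN 0 z = 0 := by simp [gradedDilation]
  have hfirst (r : ℝ) : HasDerivAt (fun r => P (gradedDilation hN r z))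
      (fderiv ℝ P (gradedDilation hN r z) (a + (2 * r) • b)) r :=
    (hP.differentiable two_ne_zero _).hasFDerivAt.comp_hasDerivAt r (hcurve r)
  have hsecond : HasDerivAt (fun r => fderiv ℝ P (gradedDilation hN r z) (a + (2 * r) • b))
      (fderiv ℝ (fderiv ℝ P) 0 a a + fderiv ℝ P 0 ((2 : ℝ) • b)) 0 := by
    have hfderiv : DifferentiableAt ℝ (fderiv ℝ P) (gradedDilation hN 0 z) :=
      (hP.fderiv_right (m := 1) (by norm_num)).differentiable one_ne_zero _
    have hcomp : HasDerivAt (fun r => fderiv ℝ P (gradedDilation hN r z))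
        (fderiv ℝ (fderiv ℝ P) (gradedDilation hN 0 z) (a + (2 * 0 : ℝ) • b)) 0 :=
      hfderiv.hasFDerivAt.comp_hasDerivAt (0 : ℝ) (hcurve 0)
    refine (hcomp.clm_apply (hasDerivAt_add_two_mul_smul a b 0)).congr_deriv ?_
    simp [hzero]
  obtain ⟨hlinear, hquadratic⟩ := derivs_eq_of_quadratic_of_forall_pos hfirst hsecond
    fun r hr => hhom r hr z
  simp only [hzero, mul_zero, zero_smul, add_zero] at hlinear
  refine ⟨hlinear.symm, ?_⟩
  rw [map_smul] at hquadratic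
  have hz : fderiv ℝ P 0 z = fderiv ℝ P 0 a + fderiv ℝ P 0 b := by
    rw [← map_add, add_sub_cancel]
  rw [hz, hlinear]
  rw [eq_sub_of_add_eq hquadratic]
  module

end HomogeneousMaps

section GroupLaw

variable {E : Type*} [NormedAddCommGroup E] [NormedSpace ℝ E]

/-- The group law is `x + y + β x y`, where the bilinear map `β` takes values in the subspace `K`
and vanishes when one of its arguments is in `K`. -/
structure IsStepTwoLaw [Group E] (K : Submodule ℝ E) (β : E →L[ℝ] E →L[ℝ] E) : Prop where
  one_eq : (1 : E) = 0
  mul_eq : ∀ x y : E, x * y = x + y + β x y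
  left : ∀ x y, x ∈ K → β x y = 0
  right : ∀ x y, y ∈ K → β x y = 0
  mem : ∀ x y, β x y ∈ K

theorem fderiv_zero_of_unital {P : E × E → E} (hP : DifferentiableAt ℝ P 0)
    (hleft : ∀ x, P (x, 0) = x) (hright : ∀ y, P (0, y) = y) (x y : E) :
    fderiv ℝ P 0 (x, y) = x + y := by
  have hinl : HasFDerivAt (fun x : E => P (x, 0)) ((fderiv ℝ P 0).comp (.inl ℝ E E)) 0 :=
    HasFDerivAt.comp (g := P) 0 hP.hasFDerivAt (hasFDerivAt_prodMk_left 0 0)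
  have hinr : HasFDerivAt (fun y : E => P (0, y)) ((fderiv ℝ P 0).comp (.inr ℝ E E)) 0 :=
    HasFDerivAt.comp (g := P) 0 hP.hasFDerivAt (hasFDerivAt_prodMk_right 0 0)
  simp only [hleft] at hinl
  simp only [hright] at hinr
  have hx := DFunLike.congr_fun (hinl.unique (hasFDerivAt_id 0)) x
  have hy := DFunLike.congr_fun (hinr.unique (hasFDerivAt_id 0)) y
  have hxy : (x, y) = (x, 0) + (0, y) := by simp
  rw [hxy, map_add]
  exact congrArg₂ _ hx hy

theorem exists_bilinear_of_homogeneous_of_unital {P : E × E → E} (hP : ContDiff ℝ 2 P)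
    {h : E →L[ℝ] E} (hhom : ∀ r, 0 < r → ∀ x y, P (gradedDilation h r x, gradedDilation h r y) =
      gradedDilation h r (P (x, y)))
    (hleft : ∀ x, P (x, 0) = x) (hright : ∀ y, P (0, y) = y) :
    ∃ β : E →L[ℝ] E →L[ℝ] E, (∀ x y, P (x, y) = x + y + β x y) ∧
      (∀ x y, h x = 0 → β x y = 0) ∧ (∀ x y, h y = 0 → β x y = 0) ∧ ∀ x y, h (β x y) = 0 := by
  have hquad := eq_quadratic_of_homogeneous hP (hN := h.prodMap h) fun r hr z => hhom r hr z.1 z.2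
  have hfderiv := fderiv_zero_of_unital (hP.differentiable two_ne_zero 0) hleft hright
  have hsymm : IsSymmSndFDerivAt ℝ P 0 := hP.contDiffAt.isSymmSndFDerivAt (by simp)
  set S := fderiv ℝ (fderiv ℝ P) 0
  have hSleft (x : E) : S (h x, 0) (h x, 0) = 0 := by
    simpa [hleft, hfderiv] using (hquad (x, 0)).2
  have hSright (y : E) : S (0, h y) (0, h y) = 0 := by
    simpa [hright, hfderiv] using (hquad (0, y)).2
  have hS (x y : E) : S (h x, h y) (h x, h y) = (2 : ℝ) • S (h x, 0) (0, h y) := by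
    have hxy : (h x, h y) = (h x, (0 : E)) + (0, h y) := by simp
    rw [hxy, map_add S, add_apply, map_add (S (h x, 0)), map_add (S (0, h y)), hSleft, hSright,
      hsymm.eq (0, h y) (h x, 0)]
    module
  have hlaw (x y : E) : P (x, y) = x + y + S (h x, 0) (0, h y) := by
    have := (hquad (x, y)).2
    rw [hfderiv] at this
    simpa [hS, smul_smul] using this
  refine ⟨S.bilinearComp ((ContinuousLinearMap.inl ℝ E E).comp h)
    ((ContinuousLinearMap.inr ℝ E E).comp h), hlaw, fun x y hx => ?_, fun x y hy => ?_,
    fun x y => ?_⟩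
  · simp [hx, ← Prod.zero_eq_mk]
  · simp [hy, ← Prod.zero_eq_mk]
  · have := (hquad (x, y)).1
    rw [hlaw, map_add, map_add] at this
    simpa [hfderiv] using this

end GroupLaw

section PositiveForms

open Module

theorem exists_linearEquiv_euclideanSpace {C : Type*} [AddCommGroup C] [Module ℝ C]
    [FiniteDimensional ℝ C] {n : ℕ} (hn : finrank ℝ C = n) (B : LinearMap.BilinForm ℝ C)
    (hsymm : ∀ v w, B v w = B w v) (hpos : ∀ v, v ≠ 0 → 0 < B v v) :
    ∃ φ : EuclideanSpace ℝ (Fin n) ≃ₗ[ℝ] C, ∀ p q, B (φ p) (φ q) = ⟪p, q⟫_ℝ := by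
  let core : InnerProductSpace.Core ℝ C :=
    { inner v w := B v w
      conj_inner_symm v w := hsymm w v
      re_inner_nonneg v := by
        obtain rfl | hv := eq_or_ne v 0
        · simp
        · exact (hpos v hv).le
      add_left u v w := by simp
      smul_left v w r := by simp
      definite v hv := by_contra fun hne => (hpos v hne).ne' hv }
  let _ : NormedAddCommGroup C := core.toNormedAddCommGroup
  let _ : InnerProductSpace ℝ C := InnerProductSpace.ofCore core.toCore
  let e := (stdOrthonormalBasis ℝ C).reindex (finCongr hn)
  exact ⟨e.repr.symm.toLinearEquiv, fun p q => e.repr.symm.inner_map_map p q⟩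

variable {L : Type*} [AddCommGroup L] [Module ℝ L] {B : LinearMap.BilinForm ℝ L}

theorem isCompl_orthogonal_of_pos [FiniteDimensional ℝ L] (hsymm : ∀ v w, B v w = B w v)
    (hpos : ∀ v, v ≠ 0 → 0 < B v v) (C : Submodule ℝ L) :
    IsCompl C (LinearMap.BilinForm.orthogonal B C) := by
  have hrefl : B.IsRefl := fun v w h => by rw [hsymm, h]
  refine LinearMap.BilinForm.isCompl_orthogonal_of_restrict_nondegenerate hrefl ?_
  refine (LinearMap.IsRefl.nondegenerate_iff_separatingLeft ?_).2 fun v hv => ?_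
  · exact fun v w h => hrefl _ _ h
  · by_contra hne
    exact (hpos v (by simpa using hne)).ne' (hv v)

theorem inner_sum_smul_of_orthonormal {m : ℕ} {X : Fin m → L}
    (hX : ∀ i j, B (X i) (X j) = if i = j then 1 else 0) (p q : EuclideanSpace ℝ (Fin m)) :
    B (∑ i, p i • X i) (∑ i, q i • X i) = ⟪p, q⟫_ℝ := by
  simp [LinearMap.sum_apply, hX, PiLp.inner_apply, mul_comm]

theorem exists_linearMap_euclideanSpace_of_orthonormal {m : ℕ} {X : Fin m → L}
    (hX : ∀ i j, B (X i) (X j) = if i = j then 1 else 0) :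
    ∃ ψ : EuclideanSpace ℝ (Fin m) →ₗ[ℝ] L, LinearMap.range ψ = Submodule.span ℝ (Set.range X) ∧
      (∀ i, ψ (EuclideanSpace.basisFun (Fin m) ℝ i) = X i) ∧
      ∀ p q, B (ψ p) (ψ q) = ⟪p, q⟫_ℝ := by
  refine ⟨(Fintype.linearCombination ℝ X).comp (WithLp.linearEquiv 2 ℝ (Fin m → ℝ)).toLinearMap,
    ?_, fun i => ?_, inner_sum_smul_of_orthonormal hX⟩
  · rw [LinearMap.range_comp_of_range_eq_top _ (LinearEquiv.range _),
      Fintype.range_linearCombination]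
  · simp

end PositiveForms

section AdaptedCoordinates

open Module ContinuousLinearMap

variable {L : Type*} [LieRing L] [LieAlgebra ℝ L] {B : LinearMap.BilinForm ℝ L}
  {V W : Type*} [NormedAddCommGroup V] [InnerProductSpace ℝ V]
  [NormedAddCommGroup W] [InnerProductSpace ℝ W]

/-- Linear coordinates on a Lie algebra in which the inner product `B` is the standard one and the
center is the second factor. -/
structure IsAdapted (B : LinearMap.BilinForm ℝ L) (Φ : (V × W) ≃ₗ[ℝ] L) : Prop where
  inner_eq : ∀ x y, B (Φ x) (Φ y) = ⟪x.1, y.1⟫_ℝ + ⟪x.2, y.2⟫_ℝ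
  mem_center_iff : ∀ y, Φ y ∈ LieAlgebra.center ℝ L ↔ y.1 = 0

theorem finrank_center_eq [FiniteDimensional ℝ L] {m n : ℕ} (hdim : finrank ℝ L = m + n)
    (hB : IsHTypeInner B) {X : Fin m → L} (hX : IsHorizontalONB B X) :
    finrank ℝ (LieAlgebra.center ℝ L).toSubmodule = n := by
  obtain ⟨ψ, hrange, -, hψ⟩ := exists_linearMap_euclideanSpace_of_orthonormal hX.1
  have hinj : Function.Injective ψ := (injective_iff_map_eq_zero ψ).2 fun p hp => by
    rw [← inner_self_eq_zero (𝕜 := ℝ), ← hψ, hp, map_zero]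
  have hhor : finrank ℝ (horizontal B) = m := by
    rw [← hX.2, ← hrange, LinearMap.finrank_range_of_inj hinj, finrank_euclideanSpace_fin]
  have := Submodule.finrank_add_eq_of_isCompl
    (isCompl_orthogonal_of_pos hB.symm hB.pos (LieAlgebra.center ℝ L).toSubmodule)
  rw [show LinearMap.BilinForm.orthogonal B _ = horizontal B from rfl] at this
  lia

theorem exists_isAdapted [FiniteDimensional ℝ L] {m n : ℕ} (hdim : finrank ℝ L = m + n)
    (hB : IsHTypeInner B) {X : Fin m → L} (hX : IsHorizontalONB B X) :
    ∃ Φ : (EuclideanSpace ℝ (Fin m) × EuclideanSpace ℝ (Fin n)) ≃ₗ[ℝ] L, IsAdapted B Φ ∧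
      ∀ i, Φ (EuclideanSpace.basisFun (Fin m) ℝ i, 0) = X i := by
  set C := (LieAlgebra.center ℝ L).toSubmodule
  obtain ⟨ψ, hrange, hψX, hψ⟩ := exists_linearMap_euclideanSpace_of_orthonormal hX.1
  obtain ⟨φ, hφ⟩ := exists_linearEquiv_euclideanSpace (finrank_center_eq hdim hB hX)
    (B.restrict C) (fun v w => hB.symm v w) fun v hv => hB.pos v (by simpa using hv)
  have hψmem (p : EuclideanSpace ℝ (Fin m)) : ψ p ∈ horizontal B := by
    rw [← hX.2, ← hrange]; exact ⟨p, rfl⟩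
  have horth (p : EuclideanSpace ℝ (Fin m)) (z : C) : B z (ψ p) = 0 := hψmem p z z.2
  let Φ₀ := ψ.coprod (C.subtype.comp φ.toLinearMap)
  have hinner (x y) : B (Φ₀ x) (Φ₀ y) = ⟪x.1, y.1⟫_ℝ + ⟪x.2, y.2⟫_ℝ := by
    have hcross : B (ψ x.1) (φ y.2 : L) = 0 := by rw [hB.symm, horth]
    have hφ' : B (φ x.2 : L) (φ y.2 : L) = ⟪x.2, y.2⟫_ℝ := hφ x.2 y.2
    simp [Φ₀, hψ, hφ', hcross, horth]
  have hinj : Function.Injective Φ₀ := (injective_iff_map_eq_zero Φ₀).2 fun y hy => by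
    have hsum := hinner y y
    rw [hy, map_zero, real_inner_self_eq_norm_sq, real_inner_self_eq_norm_sq] at hsum
    have hfst : ‖y.1‖ = 0 := by nlinarith [norm_nonneg y.1, norm_nonneg y.2]
    have hsnd : ‖y.2‖ = 0 := by nlinarith [norm_nonneg y.1, norm_nonneg y.2]
    exact Prod.ext (norm_eq_zero.1 hfst) (norm_eq_zero.1 hsnd)
  let Φ := LinearEquiv.ofInjectiveOfFinrankEq Φ₀ hinj (by simp [hdim])
  have hΦ (x) : Φ x = ψ x.1 + φ x.2 := rfl
  refine ⟨Φ, ⟨hinner, fun y => ⟨fun hy => ?_, fun hy => ?_⟩⟩, fun i => ?_⟩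
  · have hψy : B (Φ y) (ψ y.1) = 0 := hψmem y.1 (Φ y) hy
    simpa [hΦ, hψ, horth] using hψy
  · have hφy : Φ y = φ y.2 := by rw [hΦ, hy, map_zero, zero_add]
    exact hφy ▸ (φ y.2).2
  · rw [hΦ, hψX, map_zero, Submodule.coe_zero, add_zero]

namespace IsAdapted

variable {Φ : (V × W) ≃ₗ[ℝ] L} (hΦ : IsAdapted B Φ)
include hΦ

theorem mem_horizontal_iff (y : V × W) : Φ y ∈ horizontal B ↔ y.2 = 0 := by
  constructor
  · intro hy
    have : B (Φ (0, y.2)) (Φ y) = 0 := hy _ ((hΦ.mem_center_iff _).2 rfl)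
    simpa [hΦ.inner_eq] using this
  · intro hy z hz
    obtain ⟨x, rfl⟩ := Φ.surjective z
    have hx : x.1 = 0 := (hΦ.mem_center_iff x).1 hz
    simp [hΦ.inner_eq, hx, hy]

variable {b : V →L[ℝ] V →L[ℝ] W} (hlie : ∀ x y, ⁅Φ x, Φ y⁆ = Φ (0, b x.1 y.1))
include hlie

theorem norm_adjoint_bracket_of_norm_eq_one [CompleteSpace V] [CompleteSpace W]
    (hB : IsHTypeInner B) (v : V) {z : W} (hz : ‖z‖ = 1) : ‖adjoint (b v) z‖ = ‖v‖ := by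
  obtain ⟨J, hJ, hJorth⟩ := hB.orthogonal_J (Φ (0, z)) ((hΦ.mem_center_iff _).2 rfl)
    (by simp [hΦ.inner_eq, hz])
  have hmem (w : V) : Φ (w, 0) ∈ horizontal B := (hΦ.mem_horizontal_iff _).2 rfl
  obtain ⟨⟨w, w'⟩, hw⟩ := Φ.surjective (J ⟨Φ (v, 0), hmem v⟩ : L)
  obtain rfl : w' = 0 := (hΦ.mem_horizontal_iff (w, w')).1 (hw ▸ (J _).2)
  have hadjoint : w = adjoint (b v) z := ext_inner_right ℝ fun u => by
    have := hJ ⟨Φ (v, 0), hmem v⟩ ⟨Φ (u, 0), hmem u⟩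
    rw [← hw] at this
    simpa [hΦ.inner_eq, hlie, adjoint_inner_left] using this
  have hnorm := hJorth ⟨Φ (v, 0), hmem v⟩ ⟨Φ (v, 0), hmem v⟩
  rw [← hw] at hnorm
  rw [← hadjoint]
  simpa [hΦ.inner_eq] using hnorm

theorem isHTypeBracket [CompleteSpace V] [CompleteSpace W] (hB : IsHTypeInner B) :
    IsHTypeBracket b where
  self_eq_zero v := by
    have := hlie (v, 0) (v, 0)
    rw [lie_self, eq_comm, LinearEquiv.map_eq_zero_iff] at this
    exact congrArg Prod.snd this
  norm_adjoint_apply v z := by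
    obtain rfl | hz := eq_or_ne z 0
    · simp
    · have hunit : ‖(‖z‖⁻¹ • z)‖ = 1 := norm_smul_inv_norm (𝕜 := ℝ) hz
      have := hΦ.norm_adjoint_bracket_of_norm_eq_one hlie hB v hunit
      rw [map_smul, norm_smul, norm_inv, norm_norm, inv_mul_eq_iff_eq_mul₀ (by simpa using hz)]
        at this
      rw [this, mul_comm]

theorem subsingleton_iff (hB : IsHTypeInner B) : Subsingleton V ↔ Subsingleton W := by
  constructor <;> intro
  · refine subsingleton_of_forall_eq 0 fun z => ?_
    have hbracket : {y : L | ∃ v ∈ horizontal B, ∃ w ∈ horizontal B, ⁅v, w⁆ = y} ⊆ {0} := by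
      rintro _ ⟨v, -, w, -, rfl⟩
      obtain ⟨x, rfl⟩ := Φ.surjective v
      obtain ⟨y, rfl⟩ := Φ.surjective w
      simp [hlie, Subsingleton.elim x.1 0, ← Prod.zero_eq_mk]
    have hz : Φ (0, z) ∈ (LieAlgebra.center ℝ L).toSubmodule := (hΦ.mem_center_iff _).2 rfl
    rw [← hB.span_bracket] at hz
    simpa using Submodule.span_mono hbracket hz
  · refine subsingleton_of_forall_eq 0 fun v => (hΦ.mem_center_iff (v, 0)).1 ?_
    refine (LieModule.mem_maxTrivSubmodule ℝ L L _).2 fun w => ?_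
    obtain ⟨x, rfl⟩ := Φ.surjective w
    rw [hlie, Subsingleton.elim (b x.1 v) 0, ← Prod.zero_eq_mk, map_zero]

end IsAdapted

end AdaptedCoordinates

section LeftInvariant

variable {E : Type*} [NormedAddCommGroup E] [NormedSpace ℝ E] [Group E]

/-- The identification of the Lie algebra, the tangent space at the identity, with the vector space
which carries the group. -/
def toSpace : LieAlg E ≃ₗ[ℝ] E := LinearEquiv.refl ℝ E

/-- The exponential map of the group law `x * y = x + y + β x y` on a vector space. -/
def stepTwoExp (β : E →L[ℝ] E →L[ℝ] E) (x : E) : E := x + (1 / 2 : ℝ) • β x x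

/-- The left-invariant vector field given by `w`, as a map of the vector space. -/
def invariantField (w : LieAlg E) : E → E := fun x => mulInvariantVectorField w x

namespace IsStepTwoLaw

variable {K : Submodule ℝ E} {β : E →L[ℝ] E →L[ℝ] E} (h : IsStepTwoLaw K β)
include h

theorem invariantField_eq (w : LieAlg E) (x : E) :
    invariantField w x = toSpace w + β x (toSpace w) := by
  have hderiv : HasFDerivAt (fun y : E => x * y) (ContinuousLinearMap.id ℝ E + β x) 1 := by
    simp only [h.mul_eq]
    exact ((hasFDerivAt_id _).const_add x).add (β x).hasFDerivAt
  exact DFunLike.congr_fun (mfderiv_eq_fderiv.trans hderiv.fderiv) (toSpace w)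

theorem hasFDerivAt_invariantField (w : LieAlg E) (x : E) :
    HasFDerivAt (invariantField w) (β.flip (toSpace w)) x := by
  rw [show invariantField w = fun y => toSpace w + β.flip (toSpace w) y from
    funext (h.invariantField_eq w)]
  exact (β.flip (toSpace w)).hasFDerivAt.const_add _

theorem contDiff_invariantField (w : LieAlg E) : ContDiff ℝ 1 (invariantField w) := by
  rw [funext (h.invariantField_eq w)]
  fun_prop

theorem hasDerivAt_oneParameterCurve (w : LieAlg E) (t : ℝ) :
    HasDerivAt (fun s : ℝ => s • toSpace w + (s ^ 2 / 2) • β (toSpace w) (toSpace w))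
      (invariantField w (t • toSpace w + (t ^ 2 / 2) • β (toSpace w) (toSpace w))) t := by
  have hlin := (hasDerivAt_id t).smul_const (toSpace w)
  have hquad := ((hasDerivAt_pow 2 t).div_const 2).smul_const (β (toSpace w) (toSpace w))
  refine (hlin.add hquad).congr_deriv ?_
  simp [h.invariantField_eq, h.left _ _ (h.mem _ _)]

theorem isExp_iff (w : LieAlg E) (x : E) :
    IsExp w x ↔ x = stepTwoExp β (toSpace w) := by
  set k : ℝ → E := fun s => s • toSpace w + (s ^ 2 / 2) • β (toSpace w) (toSpace w) with hk
  have hk0 : k 0 = 1 := by simp [hk, h.one_eq]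
  have hk1 : k 1 = stepTwoExp β (toSpace w) := by simp [hk, stepTwoExp]
  have hkd : ∀ t, HasDerivAt k (invariantField w (k t)) t := h.hasDerivAt_oneParameterCurve w
  rw [← hk1]
  constructor
  · rintro ⟨γ, hγ0, hγ, rfl⟩
    have hlip : LipschitzWith (0 + ‖β.flip (toSpace w)‖₊) (invariantField w) := by
      rw [funext (h.invariantField_eq w)]
      exact (LipschitzWith.const (toSpace w)).add (β.flip (toSpace w)).lipschitz
    exact congrFun (ODE_solution_unique_univ (v := fun _ => invariantField w)
      (s := fun _ => Set.univ) (t₀ := 0) (fun _ => hlip.lipschitzOnWith)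
      (fun t => ⟨hγ t, trivial⟩) (fun t => ⟨hkd t, trivial⟩) (hγ0.trans hk0.symm)) 1
  · rintro rfl
    exact ⟨k, hk0, hkd, rfl⟩

theorem lie_eq (v w : LieAlg E) :
    toSpace ⁅v, w⁆ = β (toSpace v) (toSpace w) - β (toSpace w) (toSpace v) := by
  have hone (w : LieAlg E) : invariantField w 1 = toSpace w := by
    rw [h.invariantField_eq, h.one_eq, map_zero, zero_apply, add_zero]
  have hlie : toSpace ⁅v, w⁆ =
      VectorField.lieBracket ℝ (invariantField v) (invariantField w) 1 := by
    have hmlie := VectorField.mlieBracketWithin_eq_lieBracketWithin (𝕜 := ℝ) (E := E)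
      (V := mulInvariantVectorField v) (W := mulInvariantVectorField w) (s := Set.univ)
    rw [VectorField.mlieBracketWithin_univ] at hmlie
    have hlieBracket : VectorField.lieBracketWithin ℝ (invariantField v) (invariantField w)
        Set.univ = VectorField.lieBracket ℝ (invariantField v) (invariantField w) :=
      VectorField.lieBracketWithin_univ
    exact congrFun (hmlie.trans hlieBracket) 1
  rw [hlie, VectorField.lieBracket_eq]
  simp only [(h.hasFDerivAt_invariantField _ _).fderiv, hone, ContinuousLinearMap.flip_apply]

variable [CompleteSpace E] [SmoothGroup E]

theorem mem_center_of_toSpace_mem {w : LieAlg E} (hw : toSpace w ∈ K) :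
    w ∈ LieAlgebra.center ℝ (LieAlg E) := by
  refine (LieModule.mem_maxTrivSubmodule ℝ _ _ _).2 fun v => toSpace.injective ?_
  rw [h.lie_eq, h.left _ _ hw, h.right _ _ hw, sub_zero, map_zero]

end IsStepTwoLaw

end LeftInvariant

section HomogeneousGroup

open Module

variable {m n : ℕ}

variable (m n) in
/-- The projection `(x₁, x₂) ↦ (x₁, 0)`. -/
def firstProj : Space m n →L[ℝ] Space m n :=
  LinearMap.toContinuousLinearMap
    { toFun x := WithLp.toLp 2 (Sum.elim (fun i => x (Sum.inl i)) 0)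
      map_add' x y := by ext (i | i) <;> simp
      map_smul' r x := by ext (i | i) <;> simp }

@[simp]
theorem firstProj_inl (x : Space m n) (i : Fin m) : firstProj m n x (Sum.inl i) = x (Sum.inl i) :=
  rfl

@[simp]
theorem firstProj_inr (x : Space m n) (k : Fin n) : firstProj m n x (Sum.inr k) = 0 := rfl

theorem dilation_eq_gradedDilation (r : ℝ) (x : Space m n) :
    dilation r x = gradedDilation (firstProj m n) r x := by
  ext (i | i) <;> simp [dilation, gradedDilation]

theorem eq_zero_of_dilation_two_eq {x : Space m n} (hx : dilation 2 x = x) : x = 0 := by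
  ext (i | i)
  · have := congrArg (fun y : Space m n => y (Sum.inl i)) hx
    simp only [dilation, PiLp.toLp_apply, Sum.elim_inl] at this
    simpa using (by linarith : x (Sum.inl i) = 0)
  · have := congrArg (fun y : Space m n => y (Sum.inr i)) hx
    simp only [dilation, PiLp.toLp_apply, Sum.elim_inr] at this
    simpa using (by linarith : x (Sum.inr i) = 0)

variable (m n) in
theorem le_finrank_ker_firstProj : n ≤ finrank ℝ (firstProj m n).ker := by
  let ψ : (Fin n → ℝ) →ₗ[ℝ] (firstProj m n).ker :=
    { toFun q := ⟨WithLp.toLp 2 (Sum.elim 0 q), by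
        rw [LinearMap.mem_ker]
        ext (_ | _) <;> simp⟩
      map_add' p q := by ext (i | i) <;> simp
      map_smul' r q := by ext (i | i) <;> simp }
  have hψ : Function.Injective ψ := fun p q hpq => funext fun k => by
    simpa [ψ] using congrArg (fun x : (firstProj m n).ker => (x : Space m n) (Sum.inr k)) hpq
  simpa using LinearMap.finrank_le_finrank_of_injective hψ

theorem contDiff_mul (E : Type*) [NormedAddCommGroup E] [NormedSpace ℝ E] [Group E]
    [SmoothGroup E] : ContDiff ℝ ∞ fun t : E × E => t.1 * t.2 := by
  have h := contMDiff_mul 𝓘(ℝ, E) ∞ (G := E)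
  rw [← modelWithCornersSelf_prod, chartedSpaceSelf_prod] at h
  exact contMDiff_iff_contDiff.1 h

variable [Group (Space m n)] [SmoothGroup (Space m n)]

theorem exists_isStepTwoLaw (hdil : ∀ r : ℝ, 0 < r → ∀ x y : Space m n,
    dilation r (x * y) = dilation r x * dilation r y) :
    ∃ β, IsStepTwoLaw (firstProj m n).ker β := by
  have hone : (1 : Space m n) = 0 := by
    refine eq_zero_of_dilation_two_eq ?_
    simpa using hdil 2 two_pos 1 1
  simp only [dilation_eq_gradedDilation] at hdil
  obtain ⟨β, hmul, hleft, hright, hmem⟩ := exists_bilinear_of_homogeneous_of_unital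
    (P := fun t : Space m n × Space m n => t.1 * t.2) (h := firstProj m n)
    ((contDiff_mul _).of_le (by norm_cast)) (fun r hr x y => (hdil r hr x y).symm)
    (fun x => by rw [← hone, mul_one]) (fun y => by rw [← hone, one_mul])
  exact ⟨β, hone, hmul, hleft, hright, hmem⟩

theorem finrank_lieAlg : @finrank ℝ (LieAlg (Space m n)) _
    LieRing.toAddCommGroup.toAddCommMonoid LieAlgebra.toModule = m + n :=
  (toSpace (E := Space m n)).finrank_eq.trans (by simp)

instance finiteDimensional_lieAlg :
    @FiniteDimensional ℝ (LieAlg (Space m n)) _ LieRing.toAddCommGroup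
    LieAlgebra.toModule :=
  LinearEquiv.finiteDimensional (toSpace (E := Space m n)).symm

variable {B : LinearMap.BilinForm ℝ (LieAlg (Space m n))}
  {β : Space m n →L[ℝ] Space m n →L[ℝ] Space m n}

theorem IsStepTwoLaw.mem_center_iff (h : IsStepTwoLaw (firstProj m n).ker β)
    (hB : IsHTypeInner B) {X : Fin m → LieAlg (Space m n)} (hX : IsHorizontalONB B X)
    {w : LieAlg (Space m n)} :
    w ∈ LieAlgebra.center ℝ (LieAlg (Space m n)) ↔ toSpace w ∈ (firstProj m n).ker := by
  have hle : (firstProj m n).ker.comap toSpace.toLinearMap ≤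
      (LieAlgebra.center ℝ (LieAlg (Space m n))).toSubmodule :=
    fun w hw => h.mem_center_of_toSpace_mem hw
  have hrank := (finrank_center_eq finrank_lieAlg hB hX).le.trans (le_finrank_ker_firstProj m n)
  have hcomap : finrank ℝ ((firstProj m n).ker.comap toSpace.toLinearMap) =
      finrank ℝ (firstProj m n).ker := by
    rw [Submodule.comap_equiv_eq_map_symm]
    exact LinearEquiv.finrank_map_eq _ _
  have heq := Submodule.eq_of_le_of_finrank_le hle (hrank.trans_eq hcomap.symm)
  exact (SetLike.ext_iff.1 heq w).symm

end HomogeneousGroup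

section GroupChart

open Module ContinuousLinearMap

variable {E V W : Type*} [NormedAddCommGroup E] [NormedSpace ℝ E]
  [NormedAddCommGroup V] [InnerProductSpace ℝ V] [NormedAddCommGroup W] [InnerProductSpace ℝ W]
  {K : Submodule ℝ E} {β : E →L[ℝ] E →L[ℝ] E} {Φ : (V × W) ≃L[ℝ] E}

/-- Linear coordinates on `E` in which `K` is the second factor and the Lie bracket of the group
law `x * y = x + y + β x y` is `b`. -/
structure IsBracketCoordinates (K : Submodule ℝ E) (β : E →L[ℝ] E →L[ℝ] E)
    (b : V →L[ℝ] V →L[ℝ] W) (Φ : (V × W) ≃L[ℝ] E) : Prop where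
  mem_iff : ∀ y, Φ y ∈ K ↔ y.1 = 0
  bracket_eq : ∀ x y, β (Φ x) (Φ y) - β (Φ y) (Φ x) = Φ (0, b x.1 y.1)

/-- Exponential coordinates: the linear coordinates `Φ` on the Lie algebra followed by the
exponential map. -/
def expChart (β : E →L[ℝ] E →L[ℝ] E) (Φ : (V × W) ≃L[ℝ] E) : V × W → E := stepTwoExp β ∘ Φ

theorem contDiff_stepTwoExp {k : WithTop ℕ∞} : ContDiff ℝ k (stepTwoExp β) := by
  unfold stepTwoExp
  fun_prop

theorem contDiff_expChart {k : WithTop ℕ∞} : ContDiff ℝ k (expChart β Φ) :=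
  contDiff_stepTwoExp.comp Φ.contDiff

variable [Group E]

namespace IsStepTwoLaw

variable (h : IsStepTwoLaw K β)
include h

theorem bijective_stepTwoExp : Function.Bijective (stepTwoExp β) := by
  have hcancel (x : E) (r : ℝ) : β (x + r • β x x) (x + r • β x x) = β x x := by
    simp [h.left _ _ (h.mem _ _), h.right _ _ (h.mem _ _)]
  refine Function.bijective_iff_has_inverse.2
    ⟨fun x => x + (-(1 / 2) : ℝ) • β x x, fun x => ?_, fun x => ?_⟩ <;>
  simp only [stepTwoExp, hcancel] <;> module

theorem bijective_expChart : Function.Bijective (expChart β Φ) :=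
  h.bijective_stepTwoExp.comp Φ.bijective

theorem stepTwoExp_mul (x y : E) :
    stepTwoExp β x * stepTwoExp β y =
      stepTwoExp β (x + y + (1 / 2 : ℝ) • (β x y - β y x)) := by
  simp only [stepTwoExp, h.mul_eq, map_add, map_sub, map_smul, add_apply, sub_apply, smul_apply,
    h.left _ _ (h.mem _ _), h.right _ _ (h.mem _ _)]
  module

theorem fderiv_stepTwoExp (x ξ : E) :
    fderiv ℝ (stepTwoExp β) x (ξ + (1 / 2 : ℝ) • (β x ξ - β ξ x)) =
      invariantField (toSpace.symm ξ) (stepTwoExp β x) := by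
  have hderiv : HasFDerivAt (stepTwoExp β) _ x :=
    (hasFDerivAt_id x).add ((β.hasFDerivAt.clm_apply (hasFDerivAt_id x)).const_smul (1 / 2 : ℝ))
  rw [hderiv.fderiv, h.invariantField_eq]
  simp only [stepTwoExp, LinearEquiv.apply_symm_apply, h.left _ _ (h.mem _ _),
    h.right _ _ (h.mem _ _), map_add, map_sub, map_smul, add_apply, smul_apply,
    ContinuousLinearMap.id_apply, ContinuousLinearMap.comp_apply, flip_apply, id_eq]
  module

theorem exists_bilinear_coordinates (hΦ : ∀ y, Φ y ∈ K ↔ y.1 = 0) :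
    ∃ γ : V →L[ℝ] V →L[ℝ] W, ∀ x y, β (Φ x) (Φ y) = Φ (0, γ x.1 y.1) := by
  let ι : V →L[ℝ] E := Φ.toContinuousLinearMap.comp (inl ℝ V W)
  let π : E →L[ℝ] W := (snd ℝ V W).comp Φ.symm.toContinuousLinearMap
  refine ⟨((compL ℝ E E W π).comp β).bilinearComp ι ι, fun x y => ?_⟩
  have hsnd (q : W) : Φ (0, q) ∈ K := (hΦ _).2 rfl
  have hsplit (z : V × W) : Φ z = ι z.1 + Φ (0, z.2) := by simp [ι, ← map_add]
  have hfst : (Φ.symm (β (ι x.1) (ι y.1))).1 = 0 :=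
    (hΦ _).1 (by simpa using h.mem (ι x.1) (ι y.1))
  calc β (Φ x) (Φ y) = β (ι x.1) (ι y.1) := by
        rw [hsplit x, hsplit y]
        simp [h.left _ _ (hsnd _), h.right _ _ (hsnd _)]
    _ = Φ (Φ.symm (β (ι x.1) (ι y.1))) := (Φ.apply_symm_apply _).symm
    _ = Φ (0, π (β (ι x.1) (ι y.1))) := congrArg Φ (Prod.ext hfst rfl)

theorem exists_isBracketCoordinates (hΦ : ∀ y, Φ y ∈ K ↔ y.1 = 0) :
    ∃ b : V →L[ℝ] V →L[ℝ] W, IsBracketCoordinates K β b Φ := by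
  obtain ⟨γ, hγ⟩ := h.exists_bilinear_coordinates hΦ
  refine ⟨γ - γ.flip, hΦ, fun x y => ?_⟩
  rw [hγ, hγ, ← map_sub]
  simp

theorem exists_map_expChart_volume [FiniteDimensional ℝ V] [MeasurableSpace V] [BorelSpace V]
    [FiniteDimensional ℝ W] [MeasurableSpace W] [BorelSpace W] [FiniteDimensional ℝ E]
    [MeasurableSpace E] [BorelSpace E] (hΦ : ∀ y, Φ y ∈ K ↔ y.1 = 0) (μ : Measure E)
    [μ.IsAddHaarMeasure] : ∃ κ : NNReal, Measure.map (expChart β Φ) volume = κ • μ := by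
  obtain ⟨γ, hγ⟩ := h.exists_bilinear_coordinates hΦ
  have hshear : MeasurePreserving fun y : V × W => (y.1, (1 / 2 : ℝ) • γ y.1 y.1 + y.2) :=
    (MeasurePreserving.id volume).skew_product (g := fun p q => (1 / 2 : ℝ) • γ p p + q)
      (by fun_prop) (ae_of_all _ fun p => (measurePreserving_add_left volume _).map_eq)
  have hchart : expChart β Φ = Φ ∘ fun y => (y.1, (1 / 2 : ℝ) • γ y.1 y.1 + y.2) := by
    ext1 y
    simp only [expChart, stepTwoExp, Function.comp_apply, hγ, ← map_smul, ← map_add]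
    exact congrArg Φ (Prod.ext (by simp) (by simp [add_comm]))
  have := FiniteDimensional.proper_real E
  have : (volume : Measure (V × W)).IsAddHaarMeasure := by
    rw [Measure.volume_eq_prod]
    infer_instance
  have := Φ.isAddHaarMeasure_map (volume : Measure (V × W))
  refine ⟨Measure.addHaarScalarFactor (Measure.map Φ volume) μ, ?_⟩
  rw [hchart, ← Measure.map_map Φ.continuous.measurable hshear.measurable, hshear.map_eq]
  exact Measure.isAddLeftInvariant_eq_smul _ _

end IsStepTwoLaw

namespace IsBracketCoordinates

variable {b : V →L[ℝ] V →L[ℝ] W} (hΦ : IsBracketCoordinates K β b Φ) (h : IsStepTwoLaw K β)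
include hΦ h

theorem expChart_stepTwoMul (x y : V × W) :
    expChart β Φ (stepTwoMul b x y) = expChart β Φ x * expChart β Φ y := by
  simp only [expChart, Function.comp_apply, h.stepTwoExp_mul, hΦ.bracket_eq, ← map_add,
    ← map_smul]
  exact congrArg (stepTwoExp β ∘ Φ) (Prod.ext (by simp [stepTwoMul]) (by simp [stepTwoMul]))

theorem fderiv_expChart_leftField (ξ : V) (y : V × W) :
    fderiv ℝ (expChart β Φ) y (leftField b ξ y) =
      invariantField (toSpace.symm (Φ (ξ, 0))) (expChart β Φ y) := by
  have hfield : Φ (leftField b ξ y) =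
      Φ (ξ, 0) + (1 / 2 : ℝ) • (β (Φ y) (Φ (ξ, 0)) - β (Φ (ξ, 0)) (Φ y)) := by
    rw [hΦ.bracket_eq, ← map_smul, ← map_add]
    simp [leftField]
  rw [expChart, Φ.comp_right_fderiv, ContinuousLinearMap.comp_apply,
    ContinuousLinearEquiv.coe_coe, hfield, h.fderiv_stepTwoExp, Function.comp_apply]

end IsBracketCoordinates

end GroupChart

section DilatedChart

open Module

variable {m : ℕ} {E V W : Type*} [NormedAddCommGroup E] [NormedSpace ℝ E] [Group E]
  [NormedAddCommGroup V] [InnerProductSpace ℝ V] [NormedAddCommGroup W] [InnerProductSpace ℝ W]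

/-- Linear coordinates on the Lie algebra, as coordinates on the vector space which carries the
group. -/
def spaceCoordinates [FiniteDimensional ℝ V] [FiniteDimensional ℝ W]
    (Φ : (V × W) ≃ₗ[ℝ] LieAlg E) : (V × W) ≃L[ℝ] E :=
  (Φ.trans toSpace).toContinuousLinearEquiv

@[simp]
theorem spaceCoordinates_apply [FiniteDimensional ℝ V] [FiniteDimensional ℝ W]
    (Φ : (V × W) ≃ₗ[ℝ] LieAlg E) (y : V × W) : spaceCoordinates Φ y = toSpace (Φ y) := rfl

theorem IsBracketCoordinates.lie_eq [FiniteDimensional ℝ V] [FiniteDimensional ℝ W]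
    {K : Submodule ℝ E} {β : E →L[ℝ] E →L[ℝ] E} {b : V →L[ℝ] V →L[ℝ] W}
    {Φ : (V × W) ≃ₗ[ℝ] LieAlg E} (hΦ : IsBracketCoordinates K β b (spaceCoordinates Φ))
    (h : IsStepTwoLaw K β) (x y : V × W) : ⁅Φ x, Φ y⁆ = Φ (0, b x.1 y.1) :=
  toSpace.injective ((h.lie_eq _ _).trans (hΦ.bracket_eq x y))

variable [CompleteSpace E] [SmoothGroup E] {B : LinearMap.BilinForm ℝ (LieAlg E)}
  {X : Fin m → LieAlg E} {b : V →L[ℝ] V →L[ℝ] W} {e : OrthonormalBasis (Fin m) ℝ V}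
  {K : Submodule ℝ E} {β : E →L[ℝ] E →L[ℝ] E}

theorem IsAdapted.gaugeBall_eq [FiniteDimensional ℝ V] [FiniteDimensional ℝ W]
    {Φ : (V × W) ≃ₗ[ℝ] LieAlg E} (hΦ : IsAdapted B Φ) (h : IsStepTwoLaw K β) (x₀ : E) (R : ℝ) :
    gaugeBall B x₀ R =
      (x₀ * ·) '' (expChart β (spaceCoordinates Φ) '' openGaugeBall V W R) := by
  have hinner (y : V × W) (hy : y.2 = 0) (z : V × W) (hz : z.1 = 0) :
      B (Φ y) (Φ y) ^ 2 + 16 * B (Φ z) (Φ z) = gauge (y + z) := by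
    simp only [hΦ.inner_eq, hy, hz, gauge, inner_zero_left, real_inner_self_eq_norm_sq,
      Prod.fst_add, Prod.snd_add, add_zero, zero_add, ← pow_mul]
  rw [gaugeBall]
  congr 1
  ext x
  simp only [Set.mem_ofPred_eq, h.isExp_iff]
  constructor
  · rintro ⟨v, hv, z, hz, rfl, hlt⟩
    obtain ⟨y, rfl⟩ := Φ.surjective v
    obtain ⟨z, rfl⟩ := Φ.surjective z
    rw [hinner y ((hΦ.mem_horizontal_iff y).1 hv) z ((hΦ.mem_center_iff z).1 hz)] at hlt
    exact ⟨y + z, hlt, by rw [expChart, Function.comp_apply, spaceCoordinates_apply, map_add]⟩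
  · rintro ⟨y, hy, rfl⟩
    refine ⟨Φ (y.1, 0), (hΦ.mem_horizontal_iff _).2 rfl, Φ (0, y.2), (hΦ.mem_center_iff _).2 rfl,
      ?_, ?_⟩
    · rw [← map_add, Prod.fst_add_snd]
      rfl
    · rw [hinner _ rfl _ rfl, Prod.fst_add_snd]
      exact hy

variable [FiniteDimensional ℝ V] [FiniteDimensional ℝ W] [MeasurableSpace V] [BorelSpace V]
  [MeasurableSpace W] [BorelSpace W] [MeasurableSpace E]
  {μ : Measure E} {x₀ : E} {R : ℝ} {Ψ : V × W → E}

/-- A parametrization `Ψ` of the group by the model group `V × W`, carrying the balls of radius `s`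
about the origin to the balls of radius `R * s` about `x₀`, and the left invariant fields to
multiples of the left invariant fields. -/
structure IsDilatedChart (μ : Measure E) (B : LinearMap.BilinForm ℝ (LieAlg E))
    (X : Fin m → LieAlg E) (b : V →L[ℝ] V →L[ℝ] W)
    (e : OrthonormalBasis (Fin m) ℝ V) (x₀ : E) (R : ℝ) (Ψ : V × W → E) : Prop where
  contDiff : ContDiff ℝ 2 Ψ
  injective : Function.Injective Ψ
  image_openGaugeBall : ∀ s, Ψ '' openGaugeBall V W s = gaugeBall B x₀ (R * s)
  fderiv_leftField : ∀ i y,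
    fderiv ℝ Ψ y (leftField b (e i) y) = R • invariantField (X i) (Ψ y)
  exists_map_volume : ∃ κ : NNReal, Measure.map Ψ volume = κ • μ

theorem IsAdapted.exists_isDilatedChart [FiniteDimensional ℝ E] [BorelSpace E] [μ.IsAddHaarMeasure]
    {Φ : (V × W) ≃ₗ[ℝ] LieAlg E} (hΦ : IsAdapted B Φ) (hX : ∀ i, Φ (e i, 0) = X i)
    (hbracket : IsBracketCoordinates K β b (spaceCoordinates Φ)) (h : IsStepTwoLaw K β)
    (x₀ : E) (hR : 0 < R) :
    ∃ Ψ : V × W → E, IsDilatedChart μ B X b e x₀ R Ψ := by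
  set χ := expChart β (spaceCoordinates Φ)
  have hχbij : Function.Bijective χ := h.bijective_expChart
  obtain ⟨y₀, hy₀⟩ := hχbij.surjective x₀
  have hmul (y : V × W) : χ (stepTwoMul b y₀ y) = x₀ * χ y := by
    rw [← hy₀]
    exact hbracket.expChart_stepTwoMul h y₀ y
  have hχ : Continuous χ := (contDiff_expChart (k := 0)).continuous
  have hT : ContDiff ℝ 2 (stepTwoMul b y₀ ∘ dilate R) :=
    (contDiff_stepTwoMul_left b y₀).comp (contDiff_dilate R)
  have hΨ : χ ∘ stepTwoMul b y₀ ∘ dilate R = (x₀ * ·) ∘ χ ∘ dilate R :=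
    funext fun y => hmul (dilate R y)
  refine ⟨χ ∘ stepTwoMul b y₀ ∘ dilate R, contDiff_expChart.comp hT, ?_, fun s => ?_,
    fun i y => ?_, ?_⟩
  · rw [hΨ]
    exact (mul_right_injective x₀).comp (hχbij.injective.comp (bijective_dilate hR).injective)
  · rw [hΨ, Set.image_comp, Set.image_comp, image_dilate_openGaugeBall hR,
      ← hΦ.gaugeBall_eq h]
  · rw [fderiv_comp y (contDiff_expChart (k := 1).differentiable one_ne_zero _)
      (hT.differentiable two_ne_zero y), ContinuousLinearMap.comp_apply,
      fderiv_stepTwoMul_dilate_leftField, map_smul, hbracket.fderiv_expChart_leftField h,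
      spaceCoordinates_apply, hX]
    rfl
  · obtain ⟨κ, hκ⟩ := h.exists_map_expChart_volume hbracket.mem_iff μ
    refine ⟨(R ^ homDim V W)⁻¹.toNNReal * κ, ?_⟩
    rw [← Measure.map_map hχ.measurable hT.continuous.measurable,
      ← Measure.map_map (contDiff_stepTwoMul_left b y₀ (k := 0)).continuous.measurable
        (contDiff_dilate R (k := 0)).continuous.measurable, map_dilate_volume hR,
      Measure.map_smul, (measurePreserving_stepTwoMul_left b y₀).map_eq, Measure.map_smul, hκ,
      mul_smul]
    rfl

namespace IsDilatedChart

variable (hΨ : IsDilatedChart μ B X b e x₀ R Ψ)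
include hΨ

theorem isBarrierSupersolution (h : IsStepTwoLaw K β) {α : ℝ} {Ω U : Set E}
    {A : E → Matrix (Fin m) (Fin m) ℝ} {u : E → ℝ}
    (hA : ∀ x ∈ Ω, IsBarrierMatrix (finrank ℝ W) α (A x)) (hu : (U, u) ∈ supersolutions X Ω A) :
    IsBarrierSupersolution b e α (Ψ ⁻¹' U) (A ∘ Ψ) (u ∘ Ψ) := by
  obtain ⟨hU, hUΩ, hu2, hu0, hLu⟩ := hu
  refine ⟨fun y hy => hA _ (hUΩ hy), hu2.comp hΨ.contDiff.contDiffOn fun _ hy => hy,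
    fun y hy => hu0 _ hy, fun y hy => ?_⟩
  rw [secondOp_comp (hΨ.contDiff.of_le one_le_two)
    (fun i => (h.contDiff_invariantField (X i)).contDiffAt)
    (hu2.contDiffAt (hU.mem_nhds hy)) hΨ.fderiv_leftField]
  exact mul_nonpos_of_nonneg_of_nonpos (sq_nonneg R) (hLu _ hy)

theorem density_openGaugeBall [BorelSpace E] {u : E → ℝ} {ε : ENNReal}
    (hu : ε * μ (gaugeBall B x₀ R) ≤ μ {x ∈ gaugeBall B x₀ R | 1 ≤ u x}) :
    ε * volume (openGaugeBall V W 1) ≤ volume {y ∈ openGaugeBall V W 1 | 1 ≤ (u ∘ Ψ) y} := by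
  obtain ⟨κ, hκ⟩ := hΨ.exists_map_volume
  have hemb : MeasurableEmbedding Ψ := hΨ.contDiff.continuous.measurableEmbedding hΨ.injective
  have hvolume (S : Set E) : volume (Ψ ⁻¹' S) = κ * μ S := by
    rw [← hemb.map_apply, hκ]
    rfl
  have hball : openGaugeBall V W 1 = Ψ ⁻¹' gaugeBall B x₀ R := by
    rw [← mul_one R, ← hΨ.image_openGaugeBall, Set.preimage_image_eq _ hΨ.injective]
  have hsuperlevel : {y ∈ openGaugeBall V W 1 | 1 ≤ (u ∘ Ψ) y} =
      Ψ ⁻¹' {x ∈ gaugeBall B x₀ R | 1 ≤ u x} := by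
    rw [hball]
    rfl
  rw [hsuperlevel, hball, hvolume, hvolume, mul_left_comm]
  gcongr

end IsDilatedChart

theorem criticalDensity_of_forall_exists_isDilatedChart [BorelSpace E]
    {α ε κ : ℝ} (h : IsStepTwoLaw K β)
    (hchart : ∀ x₀ R, 0 < R → ∃ Ψ : V × W → E, IsDilatedChart μ B X b e x₀ R Ψ)
    (hmodel : UnitBallCriticalDensity b e α ε κ) {Ω : Set E} {A : E → Matrix (Fin m) (Fin m) ℝ}
    (hA : ∀ x ∈ Ω, IsBarrierMatrix (finrank ℝ W) α (A x)) :
    CriticalDensity μ (gaugeBall B) Ω (supersolutions X Ω A) ε κ := by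
  rintro x₀ R hR - U u hu hball hdensity x hx
  obtain ⟨Ψ, hΨ⟩ := hchart x₀ R hR
  rw [div_eq_mul_one_div, ← hΨ.image_openGaugeBall] at hx
  obtain ⟨y, hy, rfl⟩ := hx
  have hball1 : openGaugeBall V W 1 ⊆ Ψ ⁻¹' U := by
    rw [mul_comm, ← hΨ.image_openGaugeBall, Set.image_subset_iff] at hball
    exact (openGaugeBall_subset_openGaugeBall zero_le_one one_le_two).trans hball
  exact hmodel _ (hu.1.preimage hΨ.contDiff.continuous) hball1 _ _
    (hΨ.isBarrierSupersolution h hA hu) (hΨ.density_openGaugeBall hdensity) y hy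

end DilatedChart

section CriticalDensity

variable {m n : ℕ} [Group (Space m n)] [SmoothGroup (Space m n)]
  {B : LinearMap.BilinForm ℝ (LieAlg (Space m n))}

theorem exists_isAdapted_isBracketCoordinates
    (hdil : ∀ r : ℝ, 0 < r → ∀ x y : Space m n, dilation r (x * y) = dilation r x * dilation r y)
    (hB : IsHTypeInner B) {X : Fin m → LieAlg (Space m n)} (hX : IsHorizontalONB B X) :
    ∃ (β : Space m n →L[ℝ] Space m n →L[ℝ] Space m n)
      (Φ : (EuclideanSpace ℝ (Fin m) × EuclideanSpace ℝ (Fin n)) ≃ₗ[ℝ] LieAlg (Space m n))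
      (b : EuclideanSpace ℝ (Fin m) →L[ℝ] EuclideanSpace ℝ (Fin m) →L[ℝ]
        EuclideanSpace ℝ (Fin n)),
      IsStepTwoLaw (firstProj m n).ker β ∧ IsAdapted B Φ ∧
      (∀ i, Φ (EuclideanSpace.basisFun (Fin m) ℝ i, 0) = X i) ∧
      IsBracketCoordinates (firstProj m n).ker β b (spaceCoordinates Φ) := by
  obtain ⟨β, h⟩ := exists_isStepTwoLaw hdil
  obtain ⟨Φ, hΦ, hΦX⟩ := exists_isAdapted finrank_lieAlg hB hX
  obtain ⟨b, hb⟩ := h.exists_isBracketCoordinates (Φ := spaceCoordinates Φ) fun y =>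
    (h.mem_center_iff hB hX).symm.trans (hΦ.mem_center_iff y)
  exact ⟨β, Φ, b, h, hΦ, hΦX, hb⟩

theorem dim_pos_of_nontrivial [Nontrivial (Space m n)]
    (hdil : ∀ r : ℝ, 0 < r → ∀ x y : Space m n, dilation r (x * y) = dilation r x * dilation r y)
    (hB : IsHTypeInner B) {X : Fin m → LieAlg (Space m n)} (hX : IsHorizontalONB B X) :
    0 < m ∧ 0 < n := by
  obtain ⟨β, Φ, b, h, hΦ, -, hb⟩ := exists_isAdapted_isBracketCoordinates hdil hB hX
  have hsubsingleton := hΦ.subsingleton_iff (hb.lie_eq h) hB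
  have hspace : 0 < m + n := by
    simpa using Module.finrank_pos (R := ℝ) (M := Space m n)
  rw [← Module.finrank_zero_iff (R := ℝ), ← Module.finrank_zero_iff (R := ℝ),
    finrank_euclideanSpace_fin, finrank_euclideanSpace_fin] at hsubsingleton
  lia

theorem criticalDensity_of_subsingleton [Subsingleton (Space m n)] {Ω : Set (Space m n)}
    {K : Set (Set (Space m n) × (Space m n → ℝ))} :
    CriticalDensity volume (gaugeBall B) Ω K (1 / 2) 1 := by
  intro x₀ R hR _ V u _ _ hdensity x hx
  have hxR : x ∈ gaugeBall B x₀ R := by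
    obtain ⟨y, ⟨v, hv, z, hz, hexp, hlt⟩, hyx⟩ := hx
    exact ⟨y, ⟨v, hv, z, hz, hexp, hlt.trans
      (pow_lt_pow_left₀ (half_lt_self hR) (half_pos hR).le four_ne_zero)⟩, hyx⟩
  have hball : gaugeBall B x₀ R = Set.univ :=
    Set.eq_univ_of_forall fun y => Subsingleton.elim x y ▸ hxR
  have hpos : 0 < volume {y ∈ gaugeBall B x₀ R | 1 ≤ u y} := by
    refine lt_of_lt_of_le (ENNReal.mul_pos (by simp) ?_) hdensity
    rw [hball]
    exact (isOpen_univ.measure_pos _ Set.univ_nonempty).ne'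
  obtain ⟨y, -, hy⟩ := nonempty_of_measure_ne_zero hpos.ne'
  exact Subsingleton.elim y x ▸ hy

end CriticalDensity

end HType

end

open HType in
theorem theorem2p1_general (m n : ℕ) (δ : ℝ) (hδ : 0 < δ) :
    ∃ ε c : ℝ, 0 < ε ∧ ε < 1 ∧ 0 < c ∧
      ∀ [Group (Space m n)] [SmoothGroup (Space m n)],
      (∀ r : ℝ, 0 < r → ∀ x y : Space m n, dilation r (x * y) = dilation r x * dilation r y) →
      ∀ B : LinearMap.BilinForm ℝ (LieAlg (Space m n)), IsHTypeInner B →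
      ∀ X : Fin m → LieAlg (Space m n), IsHorizontalONB B X →
      ∀ (Ω : Set (Space m n)) (A : Space m n → Matrix (Fin m) (Fin m) ℝ),
        (∀ x ∈ Ω, (A x).PosDef) → (∀ x ∈ Ω, IsLandis n δ (A x)) →
        CriticalDensity volume (gaugeBall B) Ω (supersolutions X Ω A) ε c := by
  by_cases hmn : 0 < m ∧ 0 < n
  · have hm : (1 : ℝ) ≤ m := by exact_mod_cast hmn.1
    have hn : (1 : ℝ) ≤ n := by exact_mod_cast hmn.2
    obtain ⟨ε, κ, hε, hε1, hκ, hmodel⟩ := exists_unitBallCriticalDensity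
      (W := EuclideanSpace ℝ (Fin n)) (EuclideanSpace.basisFun (Fin m) ℝ)
      (α := (m + 2 * n - min δ 2) / 4) (by linarith [min_le_right δ 2]) (by
        simp only [homDim, finrank_euclideanSpace_fin]
        push_cast
        linarith [lt_min hδ two_pos])
    refine ⟨ε, κ, hε, hε1, hκ, fun hdil B hB X hX Ω A hpos hlandis => ?_⟩
    obtain ⟨β, Φ, b, h, hΦ, hΦX, hb⟩ := exists_isAdapted_isBracketCoordinates hdil hB hX
    refine criticalDensity_of_forall_exists_isDilatedChart h
      (fun x₀ R hR => hΦ.exists_isDilatedChart hΦX hb h x₀ hR)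
      (hmodel b (hΦ.isHTypeBracket (hb.lie_eq h) hB)) fun x hx => ?_
    simpa using
      ((hlandis x hx).of_le (hpos x hx).posSemidef (min_le_left δ 2)).isBarrierMatrix hmn.1
      (hpos x hx)
  · refine ⟨1 / 2, 1, by norm_num, by norm_num, one_pos, fun hdil B hB X hX Ω A _ _ => ?_⟩
    have : Subsingleton (Space m n) := not_nontrivial_iff_subsingleton.1 fun _ =>
      hmn (dim_pos_of_nontrivial hdil hB hX)
    exact criticalDensity_of_subsingleton

theorem theorem2p1 {m n : ℕ} [Group (HType.Space m n)]
    [HType.SmoothGroup (HType.Space m n)]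
    (hdil : ∀ r : ℝ, 0 < r → ∀ x y : HType.Space m n,
      HType.dilation r (x * y) = HType.dilation r x * HType.dilation r y)
    (B : LinearMap.BilinForm ℝ (HType.LieAlg (HType.Space m n))) (hB : HType.IsHTypeInner B)
    (lam Lam δ : ℝ) (hlam : 0 < lam) (hLam : lam ≤ Lam) (hδ : 0 < δ) (hδ2 : δ ≤ 2) :
    ∃ ε c : ℝ, 0 < ε ∧ ε < 1 ∧ 0 < c ∧
      ∀ X : Fin m → HType.LieAlg (HType.Space m n), HType.IsHorizontalONB B X →
      ∀ Ω : Set (HType.Space m n), IsOpen Ω →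
      ∀ A : HType.Space m n → Matrix (Fin m) (Fin m) ℝ,
        (∀ x ∈ Ω, HType.IsElliptic lam Lam (A x)) →
        (∀ x ∈ Ω, HType.IsLandis n δ (A x)) →
        HType.CriticalDensity volume (HType.gaugeBall B) Ω (HType.supersolutions X Ω A) ε c := by
  obtain ⟨ε, c, hε, hε1, hc, H⟩ := theorem2p1_general m n δ hδ
  exact ⟨ε, c, hε, hε1, hc, fun X hX Ω _ A hell hlandis =>
    H hdil B hB X hX Ω A (fun x hx => (hell x hx).posDef hlam) hlandis⟩
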